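/- **Setting.** A deterministic contextual MDP (DCMDP) consists of a horizon $H\ge 1$, a state space $\mathcal S$ partitioned into layers $\mathcal S_1,\dots,\mathcal S_H$, an action space $\mathcal A$, an initial distribution $\rho$ supported on $\mathcal S_1$, a deterministic transition map sending $\mathcal S_h\times\mathcal A$ into $\mathcal S_{h+1}$ for $h<H$, and a reward $r:\mathcal S\times\mathcal A\to\mathbb R$; all distributions are discrete. A policy is a map $\pi:\mathcal S\to\Delta(\mathcal A)$. It generates a trajectory $\tau=(s_1,a_1),\dots,(s_H,a_H)$ by $s_1\sim\rho$, $a_h\sim\pi(\cdot\mid s_h)$, with $s_{h+1}$ the successor of $(s_h,a_h)$; $d^\pi$ denotes the law of $\tau$. A trajectory is admissible if $\rho(s_1)>0$ and its states follow the transition map. Put $r(\tau)=\sum_h r(s_h,a_h)$ and $\pi(\tau)=\prod_h\pi(a_h\mid s_h)$. Assume $r(\tau)\in[0,R_{\max}]$ for all admissible $\tau$, where $R_{\max}>0$. Fix a reference policy $\pi_{\mathrm{ref}}$ and $\beta>0$, and let $$J_\beta(\pi)=\mathbb E_{\tau\sim d^\pi}\Big[r(\tau)-\beta\log\frac{\pi(\tau)}{\pi_{\mathrm{ref}}(\tau)}\Big]$$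 (equal to $-\infty$ if the KL divergence is infinite). Let $\pi^\star_\beta$ be a maximizer of $J_\beta$ over all policies. For a finite policy class $\Pi$ let $$C_{\mathsf{cov}}(\Pi)=\inf_{\mu\in\Delta((\mathcal S\times\mathcal A)^H)}\ \sup_{\tau\in(\mathcal S\times\mathcal A)^H}\ \sup_{\pi\in\Pi}\frac{d^\pi(\tau)}{\mu(\tau)} .$$ **Algorithm (XPO)** with parameters $T,\beta,\alpha$. Start with $\pi^{(1)}=\pi_{\mathrm{ref}}$. For $t=1,\dots,T$: draw $s_1^{(t)}\sim\rho$ and, independently given $s_1^{(t)}$, trajectories $\tau^{(t)}\sim\pi^{(t)}\mid s_1^{(t)}$ and $\tilde\tau^{(t)}\sim\pi_{\mathrm{ref}}\mid s_1^{(t)}$. Label them $(\tau_+^{(t)},\tau_-^{(t)})$ by a Bradley–Terry preference: $\tau^{(t)}$ is the preferred one with probability $e^{r(\tau^{(t)})}/(e^{r(\tau^{(t)})}+e^{r(\tilde\tau^{(t)})})$. Let $\pi^{(t+1)}$ be a minimizer over $\pi\in\Pi$ (ties broken arbitrarily) of $$\alpha\sum_{i=1}^t\log\pi(\tilde\tau^{(i)})-\sum_{i=1}^t\log\sigma\Big(\beta\log\frac{\pi(\tau_+^{(i)})}{\pi_{\mathrm{ref}}(\tau_+^{(i)})}-\beta\log\frac{\pi(\tau_-^{(i)})}{\pi_{\mathrm{ref}}(\tau_-^{(i)})}\Big),\qquad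 \sigma(x)=\frac{e^x}{1+e^x}.$$ The output $\hat\pi$ is a policy with the largest value of $J_\beta$ among $\pi^{(1)},\dots,\pi^{(T+1)}$. **Theorem.** For every $c>0$ there is a constant $C>0$, depending only on $c$, such that the following holds for every DCMDP, $\pi_{\mathrm{ref}}$, finite class $\Pi$, $\beta>0$, integer $T\ge2$ and $\delta\in(0,1)$. Suppose that $\pi^\star_\beta\in\Pi$, and that for all $\pi\in\Pi$ and all admissible $\tau$, $\big|\log\frac{\pi(\tau)}{\pi_{\mathrm{ref}}(\tau)}\big|\le\frac{V_{\max}}{\beta}$ (in particular $\pi(\tau)=0$ if and only if $\pi_{\mathrm{ref}}(\tau)=0$, in which case the bound is not required). Suppose $V_{\max}+R_{\max}\ge1$. If $$\alpha=c\cdot\frac{\beta}{(V_{\max}+R_{\max})e^{2R_{\max}}}\sqrt{\frac{\log(|\Pi|T\delta^{-1})}{T\,C_{\mathsf{cov}}(\Pi)}},$$ then with probability at least $1-\delta$ the output of XPO satisfies $$J_\beta(\pi^\star_\beta)-J_\beta(\hat\pi)\le C\,(V_{\max}+R_{\max})e^{2R_{\max}}\sqrt{\frac{C_{\mathsf{cov}}(\Pi)\log(|\Pi|T\delta^{-1})\log^2T}{T}}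 .$$ -/

import Mathlib

open scoped ENNReal

noncomputable section

namespace XPO

/-- A deterministic contextual MDP with horizon `H`, state space `S`, action space `A`, initial
state distribution `ρ`, deterministic transitions `next` and reward `r`. The state space is layered:
`layer s` is the (zero-based) step at which the state `s` can occur. The successor of a state of the
last layer plays no role. -/
structure DCMDP (S A : Type*) where
  H : ℕ
  H_pos : 0 < H
  layer : S → Fin H
  ρ : PMF S
  next : S → A → S
  r : S → A → ℝ
  layer_init : ∀ s ∈ ρ.support, (layer s : ℕ) = 0
  layer_next : ∀ s a, (layer s : ℕ) + 1 < H → (layer (next s a) : ℕ) = layer s + 1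

/-- A randomized policy; since the state space is layered it may depend on the time step. -/
abbrev Policy (S A : Type*) := S → PMF A

/-- The law of the next `n` state-action pairs when a policy is run from a state. -/
def rollout {S A : Type*} (next : S → A → S) (π : Policy S A) :
    (n : ℕ) → S → PMF (Fin n → S × A)
  | 0, _ => PMF.pure Fin.elim0
  | n + 1, s => (π s).bind fun a =>
      (rollout next π n (next s a)).map fun τ => Fin.cons (s, a) τ

namespace DCMDP

variable {S A : Type*} (M : DCMDP S A)

/-- Trajectories `(s₁, a₁), …, (s_H, a_H)`. -/
abbrev Traj := Fin M.H → S × A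

/-- Trajectories that can be generated by executing some policy. -/
def Admissible (τ : M.Traj) : Prop :=
  (τ ⟨0, M.H_pos⟩).1 ∈ M.ρ.support ∧
    ∀ (h : ℕ) (hh : h + 1 < M.H),
      (τ ⟨h + 1, hh⟩).1 = M.next (τ ⟨h, Nat.lt_of_succ_lt hh⟩).1 (τ ⟨h, Nat.lt_of_succ_lt hh⟩).2

/-- `r(τ)`. -/
def reward (τ : M.Traj) : ℝ := ∑ h, M.r (τ h).1 (τ h).2

/-- `π(τ) = ∏ₕ π(aₕ | sₕ)`. -/
def prob (π : Policy S A) (τ : M.Traj) : ℝ := ∏ h, (π (τ h).1 (τ h).2).toReal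

/-- The law of a trajectory of `π` given the initial state. -/
def trajLawFrom (π : Policy S A) (s : S) : PMF M.Traj := rollout M.next π M.H s

/-- The trajectory distribution `d^π`. -/
def trajLaw (π : Policy S A) : PMF M.Traj := M.ρ.bind fun s => M.trajLawFrom π s

/-- `log (π(τ) / π_ref(τ))`. -/
def logRatio (πref π : Policy S A) (τ : M.Traj) : ℝ := Real.log (M.prob π τ / M.prob πref τ)

open Classical in
/-- The KL-regularized objective `E_π[r(τ) - β log (π(τ) / π_ref(τ))]`, with value `-∞` if the
KL-divergence is infinite, that is, if `π` puts mass on trajectories with `π_ref(τ) = 0` or if the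
log-ratio is not integrable under `π`. -/
def J (πref : Policy S A) (β : ℝ) (π : Policy S A) : EReal :=
  if (∀ τ ∈ (M.trajLaw π).support, M.prob πref τ ≠ 0) ∧
      Summable (fun τ => (M.trajLaw π τ).toReal * M.logRatio πref π τ) then
    ((∑' τ, (M.trajLaw π τ).toReal * (M.reward τ - β * M.logRatio πref π τ) : ℝ) : EReal)
  else ⊥

/-- `πstar` maximizes the KL-regularized objective over all policies. -/
def IsOptimal (πref : Policy S A) (β : ℝ) (πstar : Policy S A) : Prop :=
  ∀ π : Policy S A, M.J πref β π ≤ M.J πref β πstar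

/-- Bounded density ratios: `|log (π(τ) / π_ref(τ))| ≤ Vmax / β` for all `π ∈ Π` and all
trajectories. The ratio is not allowed to be `0` or `∞`. -/
def BoundedRatios (πref : Policy S A) (β Vmax : ℝ) (Pi : Finset (Policy S A)) : Prop :=
  ∀ π ∈ Pi, ∀ τ : M.Traj, M.Admissible τ →
    (M.prob π τ = 0 ↔ M.prob πref τ = 0) ∧ |M.logRatio πref π τ| ≤ Vmax / β

/-- The trajectory-level coverability coefficient. -/
def coverability (Pi : Finset (Policy S A)) : ℝ≥0∞ :=
  ⨅ μ : PMF M.Traj, ⨆ τ : M.Traj, ⨆ π ∈ Pi, M.trajLaw π τ / μ τ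

/-- The Bradley-Terry preference: the law of the label that is `true` if `τ` is preferred over
`τ'`. -/
def bradleyTerry (τ τ' : M.Traj) : PMF Bool :=
  PMF.ofFintype
    (fun y => ENNReal.ofReal
      (Real.exp (M.reward (if y then τ else τ')) /
        (Real.exp (M.reward τ) + Real.exp (M.reward τ'))))
    (by
      rw [Fintype.sum_bool, ← ENNReal.ofReal_add (by positivity) (by positivity), ← add_div]
      simp only [if_true, Bool.false_eq_true, if_false]
      rw [div_self (by positivity), ENNReal.ofReal_one])

/-- The data of one round: the response `τ` of the current policy, the response `τ'` of the
reference policy, and the label, which is `true` if `τ` is preferred. -/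
structure Sample where
  τ : M.Traj
  τ' : M.Traj
  y : Bool

variable {M}

/-- The preferred response `τ₊`. -/
def Sample.pos (z : M.Sample) : M.Traj := if z.y then z.τ else z.τ'

/-- The other response `τ₋`. -/
def Sample.neg (z : M.Sample) : M.Traj := if z.y then z.τ' else z.τ

variable (M)

/-- The law of one round of data collection with current policy `π`: a common initial state, one
response of `π`, one response of `π_ref`, and a Bradley-Terry label. -/
def roundLaw (πref π : Policy S A) : PMF M.Sample :=
  M.ρ.bind fun s => (M.trajLawFrom π s).bind fun τ => (M.trajLawFrom πref s).bind fun τ' =>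
    (M.bradleyTerry τ τ').map fun y => ⟨τ, τ', y⟩

/-- The optimistic DPO objective for the data `D`. -/
def objective (πref : Policy S A) (β α : ℝ) (D : List M.Sample) (π : Policy S A) : ℝ :=
  α * (D.map fun z => Real.log (M.prob π z.τ')).sum -
    (D.map fun z => Real.log (Real.sigmoid
      (β * M.logRatio πref π z.pos - β * M.logRatio πref π z.neg))).sum

/-- `upd` is an update rule of the algorithm: after each round it picks, from the data so far, a
minimizer of the objective over the policy class. Ties are broken arbitrarily. -/
def IsUpdate (πref : Policy S A) (β α : ℝ) (Pi : Finset (Policy S A))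
    (upd : List M.Sample → Policy S A) : Prop :=
  ∀ D : List M.Sample, D ≠ [] → upd D ∈ Pi ∧
    ∀ π ∈ Pi, M.objective πref β α D (upd D) ≤ M.objective πref β α D π

variable {M}

/-- The policy that is played once the data `D` has been collected: `π_ref` in the first round, the
updated policy afterwards. -/
def current (πref : Policy S A) (upd : List M.Sample → Policy S A) :
    List M.Sample → Policy S A
  | [] => πref
  | z :: D => upd (z :: D)

/-- The law of the data (in chronological order) collected in the first `t` rounds. -/
def dataLaw (πref : Policy S A) (upd : List M.Sample → Policy S A) : ℕ → PMF (List M.Sample)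
  | 0 => PMF.pure []
  | t + 1 => (dataLaw πref upd t).bind fun D =>
      (M.roundLaw πref (current πref upd D)).map fun z => D ++ [z]

/-- `πhat` is an output of the algorithm after `T` rounds with data `D`: a policy with the largest
value of the objective `J` among the iterates, where iterate `t + 1` is computed from the first `t`
samples, `t = 0, …, T`. -/
def IsOutput (πref : Policy S A) (β : ℝ) (upd : List M.Sample → Policy S A) (T : ℕ)
    (D : List M.Sample) (πhat : Policy S A) : Prop :=
  (∃ t ≤ T, πhat = current πref upd (D.take t)) ∧
    ∀ t ≤ T, M.J πref β (current πref upd (D.take t)) ≤ M.J πref β πhat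

end DCMDP

end XPO

end

namespace XPO

noncomputable section

/-! ### Expectations under discrete distributions -/

section Expectation

variable {X Y : Type*}

/-- The expectation of a real-valued function. -/
def expect (p : PMF X) (f : X → ℝ) : ℝ := ∑' x, (p x).toReal * f x

/-- The expectation of an extended nonnegative function. -/
def lexpect (p : PMF X) (f : X → ℝ≥0∞) : ℝ≥0∞ := ∑' x, p x * f x

theorem lexpect_pure (a : X) (f : X → ℝ≥0∞) : lexpect (PMF.pure a) f = f a := by
  unfold lexpect
  rw [tsum_eq_single a]
  · simp
  · intro b hb
    simp [PMF.pure_apply_of_ne _ _ hb]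

theorem lexpect_bind (p : PMF X) (k : X → PMF Y) (f : Y → ℝ≥0∞) :
    lexpect (p.bind k) f = lexpect p fun a => lexpect (k a) f := by
  unfold lexpect
  simp_rw [PMF.bind_apply, ← ENNReal.tsum_mul_right, ← ENNReal.tsum_mul_left]
  rw [ENNReal.tsum_comm]
  simp_rw [mul_assoc]

theorem lexpect_map (p : PMF X) (k : X → Y) (f : Y → ℝ≥0∞) :
    lexpect (p.map k) f = lexpect p (f ∘ k) := by
  rw [← PMF.bind_pure_comp, lexpect_bind]
  simp only [Function.comp_apply, lexpect_pure]
  rfl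

theorem lexpect_congr {p : PMF X} {f g : X → ℝ≥0∞} (h : ∀ x ∈ p.support, f x = g x) :
    lexpect p f = lexpect p g := by
  refine tsum_congr fun x => ?_
  by_cases hx : p x = 0
  · simp [hx]
  · rw [h x hx]

theorem lexpect_mono {p : PMF X} {f g : X → ℝ≥0∞} (h : ∀ x ∈ p.support, f x ≤ g x) :
    lexpect p f ≤ lexpect p g := by
  refine ENNReal.tsum_le_tsum fun x => ?_
  by_cases hx : p x = 0
  · simp [hx]
  · gcongr
    exact h x hx

theorem lexpect_add (p : PMF X) (f g : X → ℝ≥0∞) :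
    lexpect p (fun x => f x + g x) = lexpect p f + lexpect p g := by
  unfold lexpect
  rw [← ENNReal.tsum_add]
  simp_rw [mul_add]

theorem lexpect_const (p : PMF X) (c : ℝ≥0∞) : lexpect p (fun _ => c) = c := by
  unfold lexpect
  rw [ENNReal.tsum_mul_right, p.tsum_coe, one_mul]

theorem lexpect_const_mul (p : PMF X) (c : ℝ≥0∞) (f : X → ℝ≥0∞) :
    lexpect p (fun x => c * f x) = c * lexpect p f := by
  unfold lexpect
  rw [← ENNReal.tsum_mul_left]
  exact tsum_congr fun x => by ring

theorem lexpect_finsetSum {ι : Type*} (p : PMF X) (s : Finset ι) (f : ι → X → ℝ≥0∞) :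
    lexpect p (fun x => ∑ i ∈ s, f i x) = ∑ i ∈ s, lexpect p (f i) := by
  classical
  induction s using Finset.induction_on with
  | empty => simp [lexpect]
  | insert a s ha ih => simp_rw [Finset.sum_insert ha, lexpect_add, ih]

theorem toOuterMeasure_eq_lexpect (p : PMF X) (s : Set X) :
    p.toOuterMeasure s = lexpect p (s.indicator 1) := by
  rw [PMF.toOuterMeasure_apply]
  refine tsum_congr fun x => ?_
  by_cases hx : x ∈ s <;> simp [hx]

theorem summable_toReal (p : PMF X) : Summable fun x => (p x).toReal :=
  ENNReal.summable_toReal p.tsum_coe_ne_top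

theorem tsum_toReal (p : PMF X) : ∑' x, (p x).toReal = 1 := by
  rw [← ENNReal.tsum_toReal_eq p.apply_ne_top, p.tsum_coe, ENNReal.toReal_one]

theorem summable_mul {p : PMF X} {f : X → ℝ} {B : ℝ} (h : ∀ x ∈ p.support, |f x| ≤ B) :
    Summable fun x => (p x).toReal * f x := by
  refine Summable.of_norm_bounded ((summable_toReal p).mul_right B) fun x => ?_
  rw [Real.norm_eq_abs, abs_mul, abs_of_nonneg ENNReal.toReal_nonneg]
  by_cases hx : p x = 0
  · simp [hx]
  · exact mul_le_mul_of_nonneg_left (h x hx) ENNReal.toReal_nonneg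

theorem expect_congr {p : PMF X} {f g : X → ℝ} (h : ∀ x ∈ p.support, f x = g x) :
    expect p f = expect p g := by
  refine tsum_congr fun x => ?_
  by_cases hx : p x = 0
  · simp [hx]
  · rw [h x hx]

theorem expect_const (p : PMF X) (c : ℝ) : expect p (fun _ => c) = c := by
  unfold expect
  rw [tsum_mul_right, tsum_toReal, one_mul]

theorem expect_add {p : PMF X} {f g : X → ℝ} {B B' : ℝ} (hf : ∀ x ∈ p.support, |f x| ≤ B)
    (hg : ∀ x ∈ p.support, |g x| ≤ B') :
    expect p (fun x => f x + g x) = expect p f + expect p g := by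
  unfold expect
  rw [← (summable_mul hf).tsum_add (summable_mul hg)]
  simp_rw [mul_add]

theorem expect_const_mul (p : PMF X) (c : ℝ) (f : X → ℝ) :
    expect p (fun x => c * f x) = c * expect p f := by
  unfold expect
  rw [← tsum_mul_left]
  exact tsum_congr fun x => by ring

theorem expect_sub {p : PMF X} {f g : X → ℝ} {B B' : ℝ} (hf : ∀ x ∈ p.support, |f x| ≤ B)
    (hg : ∀ x ∈ p.support, |g x| ≤ B') :
    expect p (fun x => f x - g x) = expect p f - expect p g := by
  unfold expect
  rw [← (summable_mul hf).tsum_sub (summable_mul hg)]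
  simp_rw [mul_sub]

theorem expect_mono {p : PMF X} {f g : X → ℝ} {B B' : ℝ} (hf : ∀ x ∈ p.support, |f x| ≤ B)
    (hg : ∀ x ∈ p.support, |g x| ≤ B') (h : ∀ x ∈ p.support, f x ≤ g x) :
    expect p f ≤ expect p g := by
  refine (summable_mul hf).tsum_le_tsum (fun x => ?_) (summable_mul hg)
  by_cases hx : p x = 0
  · simp [hx]
  · exact mul_le_mul_of_nonneg_left (h x hx) ENNReal.toReal_nonneg

theorem expect_nonneg {p : PMF X} {f : X → ℝ} (h : ∀ x ∈ p.support, 0 ≤ f x) :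
    0 ≤ expect p f := by
  refine tsum_nonneg fun x => ?_
  by_cases hx : p x = 0
  · simp [hx]
  · exact mul_nonneg ENNReal.toReal_nonneg (h x hx)

theorem abs_expect_le {p : PMF X} {f : X → ℝ} {B : ℝ} (hf : ∀ x ∈ p.support, |f x| ≤ B) :
    |expect p f| ≤ B := by
  have hB : ∀ x ∈ p.support, |B| ≤ |B| := fun _ _ => le_rfl
  have hB' : ∀ x ∈ p.support, |-B| ≤ |B| := fun _ _ => (abs_neg B).le
  refine abs_le.2 ⟨?_, ?_⟩
  · rw [← expect_const p (-B)]
    exact expect_mono hB' hf fun x hx => (abs_le.1 (hf x hx)).1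
  · rw [← expect_const p B]
    exact expect_mono hf hB fun x hx => (abs_le.1 (hf x hx)).2

theorem ofReal_expect {p : PMF X} {f : X → ℝ} {B : ℝ} (hf : ∀ x ∈ p.support, |f x| ≤ B)
    (h0 : ∀ x ∈ p.support, 0 ≤ f x) :
    ENNReal.ofReal (expect p f) = lexpect p fun x => ENNReal.ofReal (f x) := by
  unfold expect lexpect
  rw [ENNReal.ofReal_tsum_of_nonneg _ (summable_mul hf)]
  · refine tsum_congr fun x => ?_
    rw [ENNReal.ofReal_mul ENNReal.toReal_nonneg, ENNReal.ofReal_toReal (p.apply_ne_top x)]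
  · intro x
    by_cases hx : p x = 0
    · simp [hx]
    · exact mul_nonneg ENNReal.toReal_nonneg (h0 x hx)

theorem expect_bind_of_nonneg {p : PMF X} {k : X → PMF Y} {f : Y → ℝ} {B : ℝ}
    (hf : ∀ y ∈ (p.bind k).support, |f y| ≤ B) (h0 : ∀ y ∈ (p.bind k).support, 0 ≤ f y) :
    expect (p.bind k) f = expect p fun a => expect (k a) f := by
  have hs : ∀ a ∈ p.support, ∀ y ∈ (k a).support, y ∈ (p.bind k).support := fun a ha y hy =>
    (PMF.mem_support_bind_iff _ _ _).2 ⟨a, ha, hy⟩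
  have hn : ∀ a ∈ p.support, 0 ≤ expect (k a) f := fun a ha =>
    expect_nonneg fun y hy => h0 y (hs a ha y hy)
  rw [← ENNReal.toReal_ofReal (expect_nonneg h0), ← ENNReal.toReal_ofReal (expect_nonneg hn),
    ofReal_expect hf h0,
    ofReal_expect (fun a ha => abs_expect_le fun y hy => hf y (hs a ha y hy)) hn, lexpect_bind]
  congr 1
  exact lexpect_congr fun a ha =>
    (ofReal_expect (fun y hy => hf y (hs a ha y hy)) fun y hy => h0 y (hs a ha y hy)).symm

theorem expect_bind {p : PMF X} {k : X → PMF Y} {f : Y → ℝ} {B : ℝ}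
    (hf : ∀ y ∈ (p.bind k).support, |f y| ≤ B) :
    expect (p.bind k) f = expect p fun a => expect (k a) f := by
  have hs : ∀ a ∈ p.support, ∀ y ∈ (k a).support, y ∈ (p.bind k).support := fun a ha y hy =>
    (PMF.mem_support_bind_iff _ _ _).2 ⟨a, ha, hy⟩
  have hc' : ∀ y ∈ (p.bind k).support, |B| ≤ |B| := fun _ _ => le_rfl
  have h1 := expect_bind_of_nonneg (p := p) (k := k) (f := fun y => f y + B) (B := B + |B|)
    (fun y hy => (abs_add_le _ _).trans (add_le_add (hf y hy) le_rfl))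
    (fun y hy => by linarith [(abs_le.1 (hf y hy)).1])
  rw [expect_add hf hc', expect_const] at h1
  have h2 : (expect p fun a => expect (k a) fun y => f y + B) =
      expect p fun a => expect (k a) f + B := expect_congr fun a ha => by
    rw [expect_add (fun y hy => hf y (hs a ha y hy)) (B' := |B|) (fun _ _ => le_rfl), expect_const]
  rw [h2, expect_add (fun a ha => abs_expect_le fun y hy => hf y (hs a ha y hy))
    (B' := |B|) (fun _ _ => le_rfl), expect_const] at h1
  linarith

theorem expect_pure (a : X) (f : X → ℝ) : expect (PMF.pure a) f = f a := by
  unfold expect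
  rw [tsum_eq_single a]
  · simp
  · intro b hb
    simp [PMF.pure_apply_of_ne _ _ hb]

theorem expect_map {p : PMF X} {k : X → Y} {f : Y → ℝ} {B : ℝ}
    (hf : ∀ x ∈ p.support, |f (k x)| ≤ B) :
    expect (p.map k) f = expect p (fun x => f (k x)) := by
  rw [← PMF.bind_pure_comp, expect_bind (B := B)]
  · simp only [Function.comp_apply, expect_pure]
  · intro y hy
    obtain ⟨a, ha, hy⟩ := (PMF.mem_support_bind_iff _ _ _).1 hy
    rw [Function.comp_apply, PMF.mem_support_pure_iff] at hy
    exact hy ▸ hf a ha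

/-- Hoeffding's lemma for discrete distributions. -/
theorem lexpect_exp_le {p : PMF X} {f : X → ℝ} {B : ℝ} (hf : ∀ x ∈ p.support, |f x| ≤ B)
    (l : ℝ) :
    lexpect p (fun x => ENNReal.ofReal (Real.exp (l * (f x - expect p f)))) ≤
      ENNReal.ofReal (Real.exp (B ^ 2 * l ^ 2 / 2)) := by
  let _ : MeasurableSpace X := ⊤
  have : MeasurableSingletonClass X := ⟨fun _ => trivial⟩
  have hm : Measurable f := fun _ _ => trivial
  have hb : ∀ᵐ x ∂p.toMeasure, f x ∈ Set.Icc (-B) B := by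
    rw [MeasureTheory.ae_iff, PMF.toMeasure_apply_eq_zero_iff p (by trivial),
      Set.disjoint_left]
    intro x hx hx'
    exact hx' (abs_le.1 (hf x hx))
  have hsub := ProbabilityTheory.hasSubgaussianMGF_of_mem_Icc hm.aemeasurable hb
  have hint := PMF.integral_eq_tsum p f (MeasureTheory.Integrable.of_mem_Icc _ _ hm.aemeasurable hb)
  have he : ∫ x, f x ∂p.toMeasure = expect p f := by
    rw [hint]; rfl
  have h1 := hsub.mgf_le l
  rw [ProbabilityTheory.mgf, PMF.integral_eq_tsum p _ (hsub.integrable_exp_mul l), he] at h1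
  have h2 : ∀ x ∈ p.support, |Real.exp (l * (f x - expect p f))| ≤ Real.exp (|l| * (B + B)) := by
    intro x hx
    rw [abs_of_pos (Real.exp_pos _)]
    refine Real.exp_le_exp.2 ((le_abs_self _).trans ?_)
    rw [abs_mul]
    exact mul_le_mul_of_nonneg_left ((abs_sub _ _).trans
      (add_le_add (hf x hx) (abs_expect_le hf))) (abs_nonneg l)
  rw [← ofReal_expect h2 fun x _ => (Real.exp_pos _).le]
  refine ENNReal.ofReal_le_ofReal (h1.trans (Real.exp_le_exp.2 (le_of_eq ?_)))
  push_cast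
  rw [div_pow, Real.norm_eq_abs, sq_abs]
  ring

end Expectation

/-! ### Inequalities for the logistic function -/

theorem exp_neg_abs_le_sigmoid_mul (b : ℝ) :
    Real.exp (-|b|) / 4 ≤ Real.sigmoid b * Real.sigmoid (-b) := by
  have key : ∀ x : ℝ, 0 ≤ x → Real.exp (-x) / 4 ≤ Real.sigmoid x * Real.sigmoid (-x) := by
    intro x hx
    have h : (2 : ℝ)⁻¹ ≤ Real.sigmoid x := Real.sigmoid_zero ▸ Real.sigmoid_le hx
    rw [← Real.sigmoid_mul_rexp_neg]
    nlinarith [Real.exp_pos (-x), mul_le_mul h h (by norm_num) (Real.sigmoid_nonneg x)]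
  rcases le_total 0 b with hb | hb
  · rw [abs_of_nonneg hb]
    exact key b hb
  · have := key (-b) (by linarith)
    rw [neg_neg] at this
    rwa [abs_of_nonpos hb, neg_neg, mul_comm]

theorem sub_le_sigmoid_sub {a b : ℝ} (h : b ≤ a) :
    a - b ≤ 4 * Real.exp |b| * (1 + (a - b)) * (Real.sigmoid a - Real.sigmoid b) := by
  have hab : Real.sigmoid a - Real.sigmoid b =
      Real.sigmoid a * Real.sigmoid (-b) * (1 - Real.exp (-(a - b))) := by
    have e : Real.exp (-(a - b)) = Real.exp (-a) * Real.exp b := by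
      rw [← Real.exp_add]; ring_nf
    have h1 := Real.sigmoid_mul_rexp_neg a
    have h2 := Real.sigmoid_mul_rexp_neg (-b)
    rw [neg_neg] at h2
    rw [e]
    calc Real.sigmoid a - Real.sigmoid b
        = Real.sigmoid a * Real.sigmoid (-b) - Real.sigmoid (-a) * Real.sigmoid b := by
          rw [Real.sigmoid_neg, Real.sigmoid_neg]; ring
      _ = Real.sigmoid a * Real.sigmoid (-b) * (1 - Real.exp (-a) * Real.exp b) := by
          rw [← h1, ← h2]; ring
  set u := a - b with hu
  have hu0 : 0 ≤ u := by linarith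
  have hexp : u ≤ (1 + u) * (1 - Real.exp (-u)) := by
    have h1 : (1 + u) * Real.exp (-u) ≤ 1 := by
      rw [Real.exp_neg, ← div_eq_mul_inv, div_le_one (Real.exp_pos u)]
      linarith [Real.add_one_le_exp u]
    linarith
  have h1e : 0 ≤ 1 - Real.exp (-u) := by
    have : Real.exp (-u) ≤ 1 := Real.exp_le_one_iff.2 (by linarith)
    linarith
  have hs : Real.exp (-|b|) / 4 ≤ Real.sigmoid a * Real.sigmoid (-b) :=
    (exp_neg_abs_le_sigmoid_mul b).trans
      (mul_le_mul_of_nonneg_right (Real.sigmoid_le h) (Real.sigmoid_nonneg _))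
  have hone : 1 ≤ 4 * Real.exp |b| * (Real.sigmoid a * Real.sigmoid (-b)) := by
    calc (1 : ℝ) = 4 * Real.exp |b| * (Real.exp (-|b|) / 4) := by
          rw [Real.exp_neg]; field_simp
      _ ≤ _ := mul_le_mul_of_nonneg_left hs (by positivity)
  rw [hab]
  calc u ≤ (1 + u) * (1 - Real.exp (-u)) := hexp
    _ = 1 * ((1 + u) * (1 - Real.exp (-u))) := (one_mul _).symm
    _ ≤ (4 * Real.exp |b| * (Real.sigmoid a * Real.sigmoid (-b))) *
        ((1 + u) * (1 - Real.exp (-u))) :=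
          mul_le_mul_of_nonneg_right hone (by positivity)
    _ = _ := by ring

theorem abs_sub_le_sigmoid (a b : ℝ) :
    |a - b| ≤ 4 * Real.exp |b| * (1 + |a - b|) * |Real.sigmoid a - Real.sigmoid b| := by
  rcases le_total b a with h | h
  · rw [abs_of_nonneg (sub_nonneg.2 h), abs_of_nonneg (sub_nonneg.2 (Real.sigmoid_le h))]
    exact sub_le_sigmoid_sub h
  · have := sub_le_sigmoid_sub (neg_le_neg h)
    rw [Real.sigmoid_neg, Real.sigmoid_neg, abs_neg] at this
    rw [abs_sub_comm a b, abs_sub_comm (Real.sigmoid a), abs_of_nonneg (sub_nonneg.2 h),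
      abs_of_nonneg (sub_nonneg.2 (Real.sigmoid_le h))]
    convert this using 1 <;> ring

/-- The squared Hellinger distance between the Bernoulli distributions with logits `a` and `b`. -/
def hellinger (a b : ℝ) : ℝ :=
  1 - (√(Real.sigmoid a * Real.sigmoid b) + √(Real.sigmoid (-a) * Real.sigmoid (-b)))

theorem sqrt_mul_le {p q : ℝ} (hp : 0 ≤ p) (hq : 0 ≤ q) (hp1 : p ≤ 1) (hq1 : q ≤ 1) :
    √(p * q) ≤ (p + q) / 2 - (p - q) ^ 2 / 8 := by
  rw [Real.sqrt_mul hp]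
  have hx := Real.sqrt_nonneg p
  have hy := Real.sqrt_nonneg q
  have hx1 := Real.sqrt_le_one.2 hp1
  have hy1 := Real.sqrt_le_one.2 hq1
  rw [← Real.sq_sqrt hp, ← Real.sq_sqrt hq]
  rw [Real.sqrt_sq hx, Real.sqrt_sq hy]
  generalize √p = x at *
  generalize √q = y at *
  have : (x + y) ^ 2 ≤ 4 := by nlinarith
  nlinarith [mul_le_mul_of_nonneg_left this (sq_nonneg (x - y))]

theorem sq_sigmoid_sub_le_hellinger (a b : ℝ) :
    (Real.sigmoid a - Real.sigmoid b) ^ 2 ≤ 4 * hellinger a b := by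
  have h1 := sqrt_mul_le (Real.sigmoid_nonneg a) (Real.sigmoid_nonneg b) (Real.sigmoid_le_one a)
    (Real.sigmoid_le_one b)
  have h2 := sqrt_mul_le (Real.sigmoid_nonneg (-a)) (Real.sigmoid_nonneg (-b))
    (Real.sigmoid_le_one (-a)) (Real.sigmoid_le_one (-b))
  have h3 : Real.sigmoid (-a) - Real.sigmoid (-b) = -(Real.sigmoid a - Real.sigmoid b) := by
    rw [Real.sigmoid_neg, Real.sigmoid_neg]; ring
  rw [h3, neg_sq] at h2
  have h4 : Real.sigmoid (-a) + Real.sigmoid (-b) = 2 - (Real.sigmoid a + Real.sigmoid b) := by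
    rw [Real.sigmoid_neg, Real.sigmoid_neg]; ring
  rw [h4] at h2
  unfold hellinger
  linarith

theorem hellinger_nonneg (a b : ℝ) : 0 ≤ hellinger a b := by
  nlinarith [sq_sigmoid_sub_le_hellinger a b, sq_nonneg (Real.sigmoid a - Real.sigmoid b)]

theorem hellinger_le_one (a b : ℝ) : hellinger a b ≤ 1 := by
  unfold hellinger
  linarith [Real.sqrt_nonneg (Real.sigmoid a * Real.sigmoid b),
    Real.sqrt_nonneg (Real.sigmoid (-a) * Real.sigmoid (-b))]

theorem sq_sub_le_hellinger {a b R D : ℝ} (hb : |b| ≤ R) (hab : |a - b| ≤ D) :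
    (a - b) ^ 2 ≤ 64 * ((1 + D) * Real.exp R) ^ 2 * hellinger a b := by
  have h1 : |a - b| ≤ 4 * ((1 + D) * Real.exp R) * |Real.sigmoid a - Real.sigmoid b| := by
    refine (abs_sub_le_sigmoid a b).trans ?_
    refine mul_le_mul_of_nonneg_right ?_ (abs_nonneg _)
    calc 4 * Real.exp |b| * (1 + |a - b|) ≤ 4 * Real.exp R * (1 + D) := by gcongr
      _ = _ := by ring
  have h2 := pow_le_pow_left₀ (abs_nonneg _) h1 2
  rw [sq_abs, mul_pow, sq_abs] at h2
  nlinarith [mul_le_mul_of_nonneg_left (sq_sigmoid_sub_le_hellinger a b)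
    (sq_nonneg (4 * ((1 + D) * Real.exp R)))]

/-! ### Coverage -/

section Coverage

variable {X : Type*} (p : ℕ → PMF X) (m : PMF X) (C : ℝ)

/-- The mass that `p 0, …, p (t - 1)` and `C` copies of `m` put on a point. -/
def coverMass (t : ℕ) (x : X) : ℝ := ∑ i ∈ Finset.range t, (p i x).toReal + C * (m x).toReal

/-- The elliptic-potential-type quantity that measures how new `p t` is relative to
`p 0, …, p (t - 1)`. -/
def novelty (t : ℕ) (x : X) : ℝ :=
  C * (m x).toReal * (p t x).toReal / coverMass p m C t x

variable {p m C}

theorem coverMass_ge (t : ℕ) (x : X) : C * (m x).toReal ≤ coverMass p m C t x :=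
  le_add_of_nonneg_left (Finset.sum_nonneg fun _ _ => ENNReal.toReal_nonneg)

theorem coverMass_nonneg (hC : 0 ≤ C) (t : ℕ) (x : X) : 0 ≤ coverMass p m C t x :=
  (mul_nonneg hC ENNReal.toReal_nonneg).trans (coverMass_ge t x)

theorem novelty_nonneg (hC : 0 ≤ C) (t : ℕ) (x : X) : 0 ≤ novelty p m C t x :=
  div_nonneg (mul_nonneg (mul_nonneg hC ENNReal.toReal_nonneg) ENNReal.toReal_nonneg)
    (coverMass_nonneg hC t x)

theorem novelty_le (hC : 0 ≤ C) (t : ℕ) (x : X) : novelty p m C t x ≤ (p t x).toReal := by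
  unfold novelty
  rcases (coverMass_nonneg (p := p) (m := m) hC t x).eq_or_lt with h | h
  · rw [← h, div_zero]
    exact ENNReal.toReal_nonneg
  · rw [div_le_iff₀ h, mul_comm]
    exact mul_le_mul_of_nonneg_left (coverMass_ge t x) ENNReal.toReal_nonneg

theorem summable_novelty (hC : 0 ≤ C) (t : ℕ) : Summable (novelty p m C t) :=
  Summable.of_nonneg_of_le (novelty_nonneg hC t) (novelty_le hC t) (summable_toReal (p t))

theorem sum_novelty_le (hC : 0 ≤ C) (h : ∀ i x, (p i x).toReal ≤ C * (m x).toReal) (T : ℕ)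
    (x : X) :
    ∑ t ∈ Finset.range T, novelty p m C t x ≤ C * (m x).toReal * (2 * Real.log (1 + T)) := by
  rcases (mul_nonneg hC (ENNReal.toReal_nonneg (a := m x))).eq_or_lt with h0 | h0
  · simp [novelty, ← h0]
  have hw : ∀ t, 0 < coverMass p m C t x := fun t => h0.trans_le (coverMass_ge t x)
  have hstep : ∀ t, novelty p m C t x ≤ 2 * (C * (m x).toReal) *
      (Real.log (coverMass p m C (t + 1) x) - Real.log (coverMass p m C t x)) := by
    intro t
    set w := coverMass p m C t x with hwdef
    have hw' : coverMass p m C (t + 1) x = w + (p t x).toReal := by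
      rw [hwdef, coverMass, coverMass, Finset.sum_range_succ]; ring
    have hp0 : 0 ≤ (p t x).toReal := ENNReal.toReal_nonneg
    have hpw : (p t x).toReal ≤ w := (h t x).trans (coverMass_ge t x)
    have hwp : 0 < w := hw t
    have hlog := Real.one_sub_inv_le_log_of_pos (x := (w + (p t x).toReal) / w) (by positivity)
    rw [Real.log_div (by positivity) hwp.ne', inv_div] at hlog
    have h2 : (p t x).toReal / w ≤ 2 * (1 - w / (w + (p t x).toReal)) := by
      rw [div_le_iff₀ hwp]
      have : 1 - w / (w + (p t x).toReal) = (p t x).toReal / (w + (p t x).toReal) := by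
        rw [eq_div_iff (by positivity), sub_mul, div_mul_cancel₀ _ (by positivity)]
        ring
      rw [this, mul_div_assoc', div_mul_eq_mul_div, le_div_iff₀ (by positivity)]
      nlinarith
    have h3 : novelty p m C t x = C * (m x).toReal * ((p t x).toReal / w) := by
      rw [novelty, mul_div_assoc]
    rw [h3, hw']
    nlinarith [mul_le_mul_of_nonneg_left (h2.trans (mul_le_mul_of_nonneg_left hlog zero_le_two))
      h0.le]
  refine (Finset.sum_le_sum fun t _ => hstep t).trans ?_
  rw [← Finset.mul_sum, Finset.sum_range_sub (fun t => Real.log (coverMass p m C t x))]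
  rw [← Real.log_div (hw T).ne' (hw 0).ne']
  have hle : coverMass p m C T x / coverMass p m C 0 x ≤ 1 + T := by
    rw [div_le_iff₀ (hw 0)]
    have : ∑ i ∈ Finset.range T, (p i x).toReal ≤ T * (C * (m x).toReal) := by
      simpa using Finset.sum_le_card_nsmul (Finset.range T) _ _ fun i _ => h i x
    simp only [coverMass, Finset.range_zero, Finset.sum_empty, zero_add]
    linarith
  have := Real.log_le_log (div_pos (hw T) (hw 0)) hle
  nlinarith

theorem sum_tsum_novelty_le (hC : 0 ≤ C) (h : ∀ i x, (p i x).toReal ≤ C * (m x).toReal) (T : ℕ) :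
    ∑ t ∈ Finset.range T, ∑' x, novelty p m C t x ≤ 2 * C * Real.log (1 + T) := by
  rw [← Summable.tsum_finsetSum fun t _ => summable_novelty hC t]
  have hs : Summable fun x => C * (m x).toReal * (2 * Real.log (1 + T)) :=
    ((summable_toReal m).mul_left C).mul_right _
  refine (Summable.tsum_le_tsum (sum_novelty_le hC h T)
    (summable_sum fun t _ => summable_novelty hC t) hs).trans (le_of_eq ?_)
  rw [tsum_mul_right, tsum_mul_left, tsum_toReal]
  ring

/-- Change of measure from `p t` to the mixture of `p 0, …, p (t - 1)`. -/
theorem expect_abs_le_novelty (hC : 0 ≤ C) (h : ∀ i x, (p i x).toReal ≤ C * (m x).toReal)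
    {g : X → ℝ} {G η : ℝ} (hG : 0 ≤ G) (hη : 0 < η) (hg : ∀ i, ∀ x ∈ (p i).support, |g x| ≤ G)
    (t : ℕ) :
    expect (p t) (fun x => |g x|) ≤ (2 * G + 1 / η) * ∑' x, novelty p m C t x +
      η / 2 * ∑ i ∈ Finset.range t, expect (p i) (fun x => g x ^ 2) := by
  have hsq : ∀ i, Summable fun x => (p i x).toReal * g x ^ 2 := fun i =>
    summable_mul (B := G ^ 2) fun x hx => by
      rw [abs_pow]
      exact pow_le_pow_left₀ (abs_nonneg _) (hg i x hx) 2
  have hab : Summable fun x => (p t x).toReal * |g x| :=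
    summable_mul (B := G) fun x hx => by
      rw [abs_abs]
      exact hg t x hx
  have hpt : ∀ x, (p t x).toReal * |g x| ≤ (2 * G + 1 / η) * novelty p m C t x +
      η / 2 * ∑ i ∈ Finset.range t, (p i x).toReal * g x ^ 2 := by
    intro x
    have hn := novelty_nonneg (p := p) (m := m) hC t x
    have hp0 : 0 ≤ (p t x).toReal := ENNReal.toReal_nonneg
    rw [← Finset.sum_mul]
    set d := ∑ i ∈ Finset.range t, (p i x).toReal with hd
    have hd0 : 0 ≤ d := Finset.sum_nonneg fun _ _ => ENNReal.toReal_nonneg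
    have hw : coverMass p m C t x = d + C * (m x).toReal := rfl
    have hlast : 0 ≤ η / 2 * (d * g x ^ 2) := by positivity
    rcases hp0.eq_or_lt with hp | hp
    · rw [← hp, zero_mul]
      positivity
    have hgx : |g x| ≤ G := hg t x fun h0 => by simp [h0] at hp
    have hCm := hp.trans_le (h t x)
    have hnv : novelty p m C t x = C * (m x).toReal * (p t x).toReal / (d + C * (m x).toReal) := by
      rw [novelty, hw]
    have hCmp := h t x
    generalize C * (m x).toReal = c at *
    generalize (p t x).toReal = q at *
    rcases le_total d c with hdc | hdc
    · have h1 : q ≤ 2 * novelty p m C t x := by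
        rw [hnv, mul_div_assoc', le_div_iff₀ (by positivity)]
        nlinarith
      have h2 : 0 ≤ 1 / η * novelty p m C t x := by positivity
      nlinarith [mul_le_mul hgx h1 hp0 hG, abs_nonneg (g x)]
    · have hdpos : 0 < d := hCm.trans_le hdc
      have h1 : q ^ 2 / (2 * d) ≤ novelty p m C t x := by
        rw [hnv, div_le_div_iff₀ (by positivity) (by positivity)]
        nlinarith [mul_le_mul_of_nonneg_left hCmp hp0, mul_nonneg (mul_nonneg hp0 hCm.le)
          (sub_nonneg.2 hdc), mul_nonneg (mul_nonneg hp0 (sub_nonneg.2 hCmp))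
          (add_pos hdpos hCm).le]
      have h2 : q * |g x| ≤ 1 / η * (q ^ 2 / (2 * d)) + η / 2 * (d * g x ^ 2) := by
        have e : 1 / η * (q ^ 2 / (2 * d)) + η / 2 * (d * g x ^ 2) - q * |g x| =
            (q - η * d * |g x|) ^ 2 / (2 * η * d) := by
          rw [← sq_abs (g x)]
          field_simp
          ring
        have : 0 ≤ (q - η * d * |g x|) ^ 2 / (2 * η * d) := by positivity
        linarith
      have h3 : 1 / η * (q ^ 2 / (2 * d)) ≤ 1 / η * novelty p m C t x :=
        mul_le_mul_of_nonneg_left h1 (by positivity)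
      have h4 : 0 ≤ 2 * G * novelty p m C t x := by positivity
      linarith
  have hs1 := (summable_novelty (p := p) (m := m) hC t).mul_left (2 * G + 1 / η)
  have hs2 : Summable fun x => ∑ i ∈ Finset.range t, (p i x).toReal * g x ^ 2 :=
    summable_sum fun i _ => hsq i
  have := Summable.tsum_le_tsum hpt hab (hs1.add (hs2.mul_left (η / 2)))
  rw [hs1.tsum_add (hs2.mul_left (η / 2)), tsum_mul_left, tsum_mul_left,
    Summable.tsum_finsetSum fun i _ => hsq i] at this
  exact this

end Coverage

/-! ### Trajectory laws -/

section Rollout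

variable {S A : Type*}

/-- The states of `τ` start at `s` and follow the transition map. -/
def Follows (next : S → A → S) : (n : ℕ) → S → (Fin n → S × A) → Prop
  | 0, _, _ => True
  | n + 1, s, τ => (τ 0).1 = s ∧ Follows next n (next s (τ 0).2) (Fin.tail τ)

theorem follows_iff (next : S → A → S) (n : ℕ) (s : S) (τ : Fin n → S × A) :
    Follows next n s τ ↔ (∀ h : 0 < n, (τ ⟨0, h⟩).1 = s) ∧
      ∀ (h : ℕ) (hh : h + 1 < n), (τ ⟨h + 1, hh⟩).1 =
        next (τ ⟨h, Nat.lt_of_succ_lt hh⟩).1 (τ ⟨h, Nat.lt_of_succ_lt hh⟩).2 := by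
  induction n generalizing s with
  | zero => simp [Follows]
  | succ n ih =>
    rw [Follows, ih]
    constructor
    · rintro ⟨h0, h1, h2⟩
      refine ⟨fun _ => h0, fun h hh => ?_⟩
      cases h with
      | zero =>
        subst h0
        exact h1 (by omega)
      | succ h => exact h2 h (by omega)
    · rintro ⟨h0, h1⟩
      have h0 := h0 (by omega)
      refine ⟨h0, fun hn => ?_, fun h hh => h1 (h + 1) (by omega)⟩
      subst h0
      exact h1 0 (by omega)

theorem map_cons_apply {n : ℕ} (q : PMF (Fin n → S × A)) (x : S × A) (τ : Fin (n + 1) → S × A) :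
    (q.map fun τ' => (Fin.cons x τ' : Fin (n + 1) → S × A)) τ =
      (Set.indicator {y | y = x} (fun _ => q (Fin.tail τ)) (τ 0)) := by
  rw [PMF.map_apply, tsum_eq_single (Fin.tail τ)]
  · by_cases h : τ 0 = x
    · subst h
      simp
    · rw [if_neg, Set.indicator_of_notMem (by simpa using h)]
      intro h'
      exact h (by rw [h', Fin.cons_zero])
  · intro τ' hne
    rw [if_neg]
    rintro rfl
    exact hne (by simp)

theorem rollout_succ_apply (next : S → A → S) (π : Policy S A) (n : ℕ) (τ : Fin (n + 1) → S × A) :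
    rollout next π (n + 1) (τ 0).1 τ =
      π (τ 0).1 (τ 0).2 * rollout next π n (next (τ 0).1 (τ 0).2) (Fin.tail τ) := by
  rw [rollout, PMF.bind_apply, tsum_eq_single (τ 0).2]
  · rw [map_cons_apply, Set.indicator_of_mem (by simp)]
  · intro a ha
    rw [map_cons_apply, Set.indicator_of_notMem, mul_zero]
    intro h
    exact ha (by rw [show τ 0 = _ from h])

theorem rollout_apply_of_ne (next : S → A → S) (π : Policy S A) (n : ℕ) (s : S)
    (τ : Fin (n + 1) → S × A) (h : (τ 0).1 ≠ s) : rollout next π (n + 1) s τ = 0 := by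
  rw [rollout, PMF.bind_apply, ENNReal.tsum_eq_zero]
  intro a
  rw [map_cons_apply, Set.indicator_of_notMem, mul_zero]
  intro h'
  exact h (by rw [show τ 0 = _ from h'])

theorem rollout_apply (next : S → A → S) (π : Policy S A) (n : ℕ) (s : S) (τ : Fin n → S × A)
    (h : Follows next n s τ) : rollout next π n s τ = ∏ i, π (τ i).1 (τ i).2 := by
  induction n generalizing s with
  | zero =>
    rw [rollout, PMF.pure_apply, if_pos (Subsingleton.elim _ _)]
    simp
  | succ n ih =>
    obtain ⟨rfl, h⟩ := h
    rw [rollout_succ_apply, ih _ _ h, Fin.prod_univ_succ]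
    rfl

theorem follows_of_mem_support (next : S → A → S) (π : Policy S A) (n : ℕ) (s : S)
    (τ : Fin n → S × A) (h : τ ∈ (rollout next π n s).support) : Follows next n s τ := by
  induction n generalizing s with
  | zero => trivial
  | succ n ih =>
    rw [PMF.mem_support_iff] at h
    have h0 : (τ 0).1 = s := by
      by_contra hne
      exact h (rollout_apply_of_ne next π n s τ hne)
    subst h0
    rw [rollout_succ_apply] at h
    exact ⟨rfl, ih _ _ (right_ne_zero_of_mul h)⟩

end Rollout

namespace DCMDP

variable {S A : Type*} (M : DCMDP S A)

/-- The initial state of a trajectory. -/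
def initState (τ : M.Traj) : S := (τ ⟨0, M.H_pos⟩).1

theorem admissible_iff (τ : M.Traj) :
    M.Admissible τ ↔ M.initState τ ∈ M.ρ.support ∧ Follows M.next M.H (M.initState τ) τ := by
  rw [follows_iff]
  exact ⟨fun h => ⟨h.1, fun _ => rfl, h.2⟩, fun h => ⟨h.1, h.2.2⟩⟩

theorem toReal_prod_eq_prob (π : Policy S A) (τ : M.Traj) :
    (∏ h, π (τ h).1 (τ h).2).toReal = M.prob π τ := ENNReal.toReal_prod _ _

theorem follows_of_mem_support_trajLawFrom {π : Policy S A} {s : S} {τ : M.Traj}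
    (h : τ ∈ (M.trajLawFrom π s).support) : Follows M.next M.H s τ :=
  follows_of_mem_support _ _ _ _ _ h

theorem initState_of_mem_support {π : Policy S A} {s : S} {τ : M.Traj}
    (h : τ ∈ (M.trajLawFrom π s).support) : M.initState τ = s :=
  ((follows_iff _ _ _ _).1 (M.follows_of_mem_support_trajLawFrom h)).1 M.H_pos

theorem admissible_of_mem_support_trajLawFrom {π : Policy S A} {s : S} {τ : M.Traj}
    (hs : s ∈ M.ρ.support) (h : τ ∈ (M.trajLawFrom π s).support) : M.Admissible τ := by
  have h0 := M.initState_of_mem_support h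
  rw [admissible_iff, h0]
  exact ⟨hs, M.follows_of_mem_support_trajLawFrom h⟩

theorem trajLawFrom_toReal {π : Policy S A} {s : S} {τ : M.Traj}
    (h : Follows M.next M.H s τ) : (M.trajLawFrom π s τ).toReal = M.prob π τ := by
  rw [trajLawFrom, rollout_apply _ _ _ _ _ h, toReal_prod_eq_prob]

theorem trajLaw_apply (π : Policy S A) (τ : M.Traj) :
    M.trajLaw π τ = M.ρ (M.initState τ) * M.trajLawFrom π (M.initState τ) τ := by
  rw [trajLaw, PMF.bind_apply, tsum_eq_single (M.initState τ)]
  intro s hs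
  by_contra h
  exact hs (M.initState_of_mem_support (π := π) (right_ne_zero_of_mul h)).symm

theorem trajLaw_toReal {π : Policy S A} {τ : M.Traj} (h : M.Admissible τ) :
    (M.trajLaw π τ).toReal = (M.ρ (M.initState τ)).toReal * M.prob π τ := by
  rw [trajLaw_apply, ENNReal.toReal_mul, M.trajLawFrom_toReal ((M.admissible_iff τ).1 h).2]

theorem mem_support_trajLaw {π : Policy S A} {τ : M.Traj} :
    τ ∈ (M.trajLaw π).support ↔ M.Admissible τ ∧ M.prob π τ ≠ 0 := by
  constructor
  · intro h
    have h' := h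
    rw [PMF.mem_support_iff, trajLaw_apply] at h'
    have hs : M.initState τ ∈ M.ρ.support := left_ne_zero_of_mul h'
    have ha := M.admissible_of_mem_support_trajLawFrom hs (right_ne_zero_of_mul h')
    refine ⟨ha, fun h0 => ?_⟩
    have := M.trajLaw_toReal (π := π) ha
    rw [h0, mul_zero, ENNReal.toReal_eq_zero_iff] at this
    exact this.elim h ((M.trajLaw π).apply_ne_top τ)
  · rintro ⟨ha, hp⟩ h0
    have := M.trajLaw_toReal (π := π) ha
    rw [h0, ENNReal.toReal_zero, eq_comm, mul_eq_zero, ENNReal.toReal_eq_zero_iff] at this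
    rcases this with (h | h) | h
    · exact ((M.admissible_iff τ).1 ha).1 h
    · exact M.ρ.apply_ne_top _ h
    · exact hp h

/-- The expectation of a function of the initial state does not depend on the policy. -/
theorem expect_trajLaw_initState (π : Policy S A) {f : S → ℝ} {B : ℝ}
    (hf : ∀ s ∈ M.ρ.support, |f s| ≤ B) :
    expect (M.trajLaw π) (fun τ => f (M.initState τ)) = expect M.ρ f := by
  rw [trajLaw, expect_bind (B := B)]
  · refine expect_congr fun s _ => ?_
    rw [expect_congr (g := fun _ => f s) fun τ hτ => by
      rw [M.initState_of_mem_support hτ], expect_const]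
  · intro τ hτ
    exact hf _ ((M.admissible_iff τ).1 (M.mem_support_trajLaw.1 hτ).1).1

end DCMDP

/-! ### The optimal policy -/

/-- Gibbs' inequality with its equality case. -/
theorem eq_of_expect_log_le_zero {X : Type*} {p q : PMF X} {B : ℝ}
    (hq : ∀ x ∈ p.support, q x ≠ 0)
    (hB : ∀ x ∈ p.support, |Real.log ((p x).toReal / (q x).toReal)| ≤ B)
    (h : expect p (fun x => Real.log ((p x).toReal / (q x).toReal)) ≤ 0) (x : X) :
    (p x).toReal = (q x).toReal := by
  set F : X → ℝ := fun x => (p x).toReal * Real.log ((p x).toReal / (q x).toReal) +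
    ((q x).toReal - (p x).toReal) with hF
  have hpos : ∀ x, p x ≠ 0 → 0 < (p x).toReal ∧ 0 < (q x).toReal := fun x hx =>
    ⟨ENNReal.toReal_pos hx (p.apply_ne_top x), ENNReal.toReal_pos (hq x hx) (q.apply_ne_top x)⟩
  have hFeq : ∀ x, p x ≠ 0 → F x = (p x).toReal * ((q x).toReal / (p x).toReal - 1 -
      Real.log ((q x).toReal / (p x).toReal)) := by
    intro x hx
    obtain ⟨h1, h2⟩ := hpos x hx
    simp only [hF]
    rw [← inv_div (q x).toReal, Real.log_inv]
    field_simp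
    ring
  have hF0 : ∀ x, 0 ≤ F x := by
    intro x
    by_cases hx : p x = 0
    · simp [hF, hx]
    · obtain ⟨h1, h2⟩ := hpos x hx
      rw [hFeq x hx]
      exact mul_nonneg h1.le (by linarith [Real.log_le_sub_one_of_pos (div_pos h2 h1)])
  have hs1 := summable_mul hB
  have hs2 := (summable_toReal q).sub (summable_toReal p)
  have hFs : Summable F := hs1.add hs2
  have hFt : ∑' x, F x ≤ 0 := by
    rw [hF, hs1.tsum_add hs2, (summable_toReal q).tsum_sub (summable_toReal p), tsum_toReal,
      tsum_toReal]
    have : (∑' x, (p x).toReal * Real.log ((p x).toReal / (q x).toReal)) ≤ 0 := h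
    linarith
  have hz : F x = 0 :=
    congrFun ((hasSum_zero_iff_of_nonneg hF0).1
      ((le_antisymm hFt (tsum_nonneg hF0)) ▸ hFs.hasSum)) x
  by_cases hx : p x = 0
  · simp only [hF, hx, ENNReal.toReal_zero, zero_mul, zero_add, sub_zero] at hz
    rw [hx, hz, ENNReal.toReal_zero]
  · obtain ⟨h1, h2⟩ := hpos x hx
    rw [hFeq x hx] at hz
    by_contra hne
    have := Real.log_lt_sub_one_of_pos (div_pos h2 h1) fun h' =>
      hne ((div_eq_one_iff_eq h1.ne').1 h').symm
    rcases mul_eq_zero.1 hz with h' | h'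
    · exact h1.ne' h'
    · linarith

section SoftOptimal

variable {S A : Type*}

/-- The partition function: the expectation of `exp (r(τ) / β)` over the next `n` steps of a
policy. -/
def partition (next : S → A → S) (r : S → A → ℝ) (β : ℝ) (π : Policy S A) : ℕ → S → ℝ≥0∞
  | 0, _ => 1
  | n + 1, s => ∑' a, π s a *
      (ENNReal.ofReal (Real.exp (r s a / β)) * partition next r β π n (next s a))

theorem partition_eq_lexpect (next : S → A → S) (r : S → A → ℝ) (β : ℝ) (π : Policy S A) (n : ℕ)
    (s : S) : partition next r β π n s = lexpect (rollout next π n s)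
      fun τ => ENNReal.ofReal (Real.exp ((∑ h, r (τ h).1 (τ h).2) / β)) := by
  induction n generalizing s with
  | zero => simp [partition, rollout, lexpect_pure]
  | succ n ih =>
    rw [partition, rollout, lexpect_bind]
    refine tsum_congr fun a => ?_
    rw [ih]
    beta_reduce
    rw [lexpect_map, ← lexpect_const_mul]
    congr 2
    funext τ
    simp only [Function.comp_apply]
    rw [← ENNReal.ofReal_mul (Real.exp_pos _).le, ← Real.exp_add, Fin.sum_univ_succ]
    simp only [Fin.cons_zero, Fin.cons_succ, add_div]

theorem partition_ne_zero (next : S → A → S) (r : S → A → ℝ) (β : ℝ) (π : Policy S A) (n : ℕ)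
    (s : S) : partition next r β π n s ≠ 0 := by
  induction n generalizing s with
  | zero => simp [partition]
  | succ n ih =>
    rw [partition]
    intro h
    rw [ENNReal.tsum_eq_zero] at h
    obtain ⟨a, ha⟩ := (π s).support_nonempty
    refine (mul_ne_zero ha (mul_ne_zero ?_ (ih (next s a)))) (h a)
    simp [Real.exp_pos]

namespace DCMDP

variable (M : DCMDP S A)

/-- The unnormalized weight that the soft-optimal policy gives to an action. -/
def softWeight (β : ℝ) (π : Policy S A) (s : S) (a : A) : ℝ≥0∞ :=
  π s a * (ENNReal.ofReal (Real.exp (M.r s a / β)) *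
    partition M.next M.r β π (M.H - M.layer s - 1) (M.next s a))

theorem tsum_softWeight_ne_zero (β : ℝ) (π : Policy S A) (s : S) :
    ∑' a, M.softWeight β π s a ≠ 0 :=
  partition_ne_zero M.next M.r β π (M.H - M.layer s - 1 + 1) s

open Classical in
/-- The soft-optimal policy: it reweights `π` by `exp (Q / β)`, where `Q` is the soft value of an
action. -/
def softPolicy (β : ℝ) (π : Policy S A) : Policy S A := fun s =>
  if h : ∑' a, M.softWeight β π s a ≠ ⊤ then
    PMF.normalize (M.softWeight β π s) (M.tsum_softWeight_ne_zero β π s) h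
  else π s

theorem softPolicy_mul_partition {β : ℝ} {π : Policy S A} {n : ℕ} {s : S}
    (hn : (M.layer s : ℕ) + (n + 1) = M.H) (h : partition M.next M.r β π (n + 1) s ≠ ⊤) (a : A) :
    M.softPolicy β π s a * partition M.next M.r β π (n + 1) s =
      π s a * (ENNReal.ofReal (Real.exp (M.r s a / β)) *
        partition M.next M.r β π n (M.next s a)) := by
  have hn' : n = M.H - M.layer s - 1 := by omega
  subst hn'
  have he : partition M.next M.r β π (M.H - M.layer s - 1 + 1) s =
    ∑' a, M.softWeight β π s a := rfl
  rw [he] at h ⊢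
  rw [softPolicy, dif_pos h, PMF.normalize_apply, mul_assoc,
    ENNReal.inv_mul_cancel (M.tsum_softWeight_ne_zero β π s) h, mul_one, softWeight]

theorem prod_softPolicy_mul_partition {β : ℝ} {π : Policy S A} (n : ℕ) (s : S)
    (τ : Fin n → S × A) (hτ : Follows M.next n s τ)
    (hn : 0 < n → (M.layer s : ℕ) + n = M.H) (h : partition M.next M.r β π n s ≠ ⊤) :
    (∏ i, M.softPolicy β π (τ i).1 (τ i).2) * partition M.next M.r β π n s =
      (∏ i, π (τ i).1 (τ i).2) *
        ENNReal.ofReal (Real.exp ((∑ i, M.r (τ i).1 (τ i).2) / β)) := by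
  induction n generalizing s with
  | zero => simp [partition]
  | succ n ih =>
    obtain ⟨rfl, hτ⟩ := hτ
    have hstep := M.softPolicy_mul_partition (hn (by omega)) h (τ 0).2
    rw [Fin.prod_univ_succ, Fin.prod_univ_succ, Fin.sum_univ_succ, mul_right_comm, hstep]
    by_cases ha : π (τ 0).1 (τ 0).2 = 0
    · simp [ha]
    have hfin : partition M.next M.r β π n (M.next (τ 0).1 (τ 0).2) ≠ ⊤ := by
      intro htop
      refine h (top_unique ?_)
      rw [partition]
      refine le_trans (le_of_eq ?_) (ENNReal.le_tsum (τ 0).2)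
      rw [htop, ENNReal.mul_top (by simp [Real.exp_pos]), ENNReal.mul_top ha]
    have := ih _ _ hτ (fun h0 => by
      rw [M.layer_next _ _ (by have := hn (by omega); omega)]
      have := hn (by omega)
      omega) hfin
    simp only [Fin.tail] at this
    rw [add_div, Real.exp_add, ENNReal.ofReal_mul (Real.exp_pos _).le]
    calc _ = π (τ 0).1 (τ 0).2 * ENNReal.ofReal (Real.exp (M.r (τ 0).1 (τ 0).2 / β)) *
          ((∏ i : Fin n, M.softPolicy β π (τ i.succ).1 (τ i.succ).2) *
            partition M.next M.r β π n (M.next (τ 0).1 (τ 0).2)) := by ring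
      _ = _ := by rw [this]; ring

/-- The soft value of an initial state. -/
def softValue (β : ℝ) (π : Policy S A) (s : S) : ℝ :=
  β * Real.log (partition M.next M.r β π M.H s).toReal

variable {M} {πref πstar : Policy S A} {β Rmax : ℝ}

theorem partition_bounds (hβ : 0 < β)
    (hr : ∀ τ : M.Traj, M.Admissible τ → 0 ≤ M.reward τ ∧ M.reward τ ≤ Rmax) {s : S}
    (hs : s ∈ M.ρ.support) :
    1 ≤ partition M.next M.r β πref M.H s ∧
      partition M.next M.r β πref M.H s ≤ ENNReal.ofReal (Real.exp (Rmax / β)) := by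
  rw [partition_eq_lexpect]
  constructor
  · rw [← lexpect_const (rollout M.next πref M.H s) 1]
    refine lexpect_mono fun τ hτ => ?_
    have := (hr τ (M.admissible_of_mem_support_trajLawFrom hs hτ)).1
    rw [ENNReal.one_le_ofReal, Real.one_le_exp_iff]
    exact div_nonneg this hβ.le
  · refine le_trans (lexpect_mono fun τ hτ => ?_) (lexpect_const (rollout M.next πref M.H s) _).le
    have := (hr τ (M.admissible_of_mem_support_trajLawFrom hs hτ)).2
    refine ENNReal.ofReal_le_ofReal (Real.exp_le_exp.2 ?_)
    exact div_le_div_of_nonneg_right this hβ.le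

theorem softValue_mem (hβ : 0 < β)
    (hr : ∀ τ : M.Traj, M.Admissible τ → 0 ≤ M.reward τ ∧ M.reward τ ≤ Rmax) {s : S}
    (hs : s ∈ M.ρ.support) : 0 ≤ M.softValue β πref s ∧ M.softValue β πref s ≤ Rmax := by
  obtain ⟨h1, h2⟩ := partition_bounds (πref := πref) hβ hr hs
  have htop : partition M.next M.r β πref M.H s ≠ ⊤ := ne_top_of_le_ne_top ENNReal.ofReal_ne_top h2
  have h1' : 1 ≤ (partition M.next M.r β πref M.H s).toReal := by
    simpa using ENNReal.toReal_mono htop h1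
  have h2' : (partition M.next M.r β πref M.H s).toReal ≤ Real.exp (Rmax / β) :=
    ENNReal.toReal_le_of_le_ofReal (Real.exp_pos _).le h2
  refine ⟨mul_nonneg hβ.le (Real.log_nonneg h1'), ?_⟩
  have := Real.log_le_log (by linarith) h2'
  rw [Real.log_exp] at this
  calc M.softValue β πref s ≤ β * (Rmax / β) := mul_le_mul_of_nonneg_left this hβ.le
    _ = Rmax := by field_simp

theorem prob_softPolicy (hβ : 0 < β)
    (hr : ∀ τ : M.Traj, M.Admissible τ → 0 ≤ M.reward τ ∧ M.reward τ ≤ Rmax) {τ : M.Traj}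
    (hτ : M.Admissible τ) :
    M.prob (M.softPolicy β πref) τ =
      M.prob πref τ * Real.exp ((M.reward τ - M.softValue β πref (M.initState τ)) / β) := by
  obtain ⟨hs, hf⟩ := (M.admissible_iff τ).1 hτ
  obtain ⟨h1, h2⟩ := partition_bounds (πref := πref) hβ hr hs
  have htop := ne_top_of_le_ne_top ENNReal.ofReal_ne_top h2
  have h := M.prod_softPolicy_mul_partition M.H (M.initState τ) τ hf
    (fun _ => by rw [M.layer_init _ hs, zero_add]) htop
  have h := congrArg ENNReal.toReal h
  rw [ENNReal.toReal_mul, ENNReal.toReal_mul, toReal_prod_eq_prob, toReal_prod_eq_prob,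
    ENNReal.toReal_ofReal (Real.exp_pos _).le] at h
  have hpos : 0 < (partition M.next M.r β πref M.H (M.initState τ)).toReal :=
    ENNReal.toReal_pos (partition_ne_zero _ _ _ _ _ _) htop
  rw [sub_div, softValue, mul_div_cancel_left₀ _ hβ.ne', Real.exp_sub, Real.exp_log hpos,
    mul_div_assoc', eq_div_iff hpos.ne', h]
  rfl

theorem logRatio_softPolicy (hβ : 0 < β)
    (hr : ∀ τ : M.Traj, M.Admissible τ → 0 ≤ M.reward τ ∧ M.reward τ ≤ Rmax) {τ : M.Traj}
    (hτ : M.Admissible τ) (h0 : M.prob πref τ ≠ 0) :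
    β * M.logRatio πref (M.softPolicy β πref) τ =
      M.reward τ - M.softValue β πref (M.initState τ) := by
  rw [logRatio, prob_softPolicy hβ hr hτ, mul_div_cancel_left₀ _ h0, Real.log_exp]
  field_simp

/-- A formula for the objective of a policy whose log-ratios are bounded. -/
theorem J_eq {π : Policy S A} {B : ℝ} (h0 : ∀ τ ∈ (M.trajLaw π).support, M.prob πref τ ≠ 0)
    (hB : ∀ τ ∈ (M.trajLaw π).support, |M.logRatio πref π τ| ≤ B) :
    M.J πref β π = ((expect (M.trajLaw π)
      (fun τ => M.reward τ - β * M.logRatio πref π τ) : ℝ) : EReal) := by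
  rw [J, if_pos ⟨h0, summable_mul hB⟩]
  rfl

theorem J_softPolicy (hβ : 0 < β)
    (hr : ∀ τ : M.Traj, M.Admissible τ → 0 ≤ M.reward τ ∧ M.reward τ ≤ Rmax) :
    M.J πref β (M.softPolicy β πref) = ((expect M.ρ (M.softValue β πref) : ℝ) : EReal) := by
  have h0 : ∀ τ ∈ (M.trajLaw (M.softPolicy β πref)).support, M.prob πref τ ≠ 0 := by
    intro τ hτ h
    obtain ⟨ha, hp⟩ := M.mem_support_trajLaw.1 hτ
    rw [prob_softPolicy hβ hr ha, h, zero_mul] at hp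
    exact hp rfl
  have hlr : ∀ τ ∈ (M.trajLaw (M.softPolicy β πref)).support,
      β * M.logRatio πref (M.softPolicy β πref) τ =
        M.reward τ - M.softValue β πref (M.initState τ) := fun τ hτ =>
    logRatio_softPolicy hβ hr (M.mem_support_trajLaw.1 hτ).1 (h0 τ hτ)
  rw [J_eq (B := Rmax / β) h0]
  · rw [expect_congr (g := fun τ => M.softValue β πref (M.initState τ)) fun τ hτ => by
      rw [hlr τ hτ]; ring]
    rw [M.expect_trajLaw_initState (B := Rmax)]
    intro s hs
    obtain ⟨h1, h2⟩ := softValue_mem (πref := πref) hβ hr hs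
    exact abs_le.2 ⟨by linarith, h2⟩
  · intro τ hτ
    have ha := (M.mem_support_trajLaw.1 hτ).1
    obtain ⟨h1, h2⟩ := softValue_mem (πref := πref) hβ hr ((M.admissible_iff τ).1 ha).1
    obtain ⟨h3, h4⟩ := hr τ ha
    rw [le_div_iff₀ hβ, mul_comm, ← abs_of_pos hβ, ← abs_mul, abs_of_pos hβ, hlr τ hτ]
    exact abs_le.2 ⟨by linarith, by linarith⟩

/-- Where the reference policy is positive, a maximizer of the objective has the log-ratio
`(r(τ) - V(s₁)) / β`. -/
theorem IsOptimal.logRatio_eq (hβ : 0 < β)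
    (hr : ∀ τ : M.Traj, M.Admissible τ → 0 ≤ M.reward τ ∧ M.reward τ ≤ Rmax)
    (hopt : M.IsOptimal πref β πstar) {B : ℝ}
    (hb : ∀ τ : M.Traj, M.Admissible τ →
      (M.prob πstar τ = 0 ↔ M.prob πref τ = 0) ∧ |M.logRatio πref πstar τ| ≤ B)
    {τ : M.Traj} (hτ : M.Admissible τ) (h0 : M.prob πref τ ≠ 0) :
    β * M.logRatio πref πstar τ = M.reward τ - M.softValue β πref (M.initState τ) := by
  have hV : ∀ s ∈ M.ρ.support, |M.softValue β πref s| ≤ Rmax := by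
    intro s hs
    obtain ⟨h1, h2⟩ := softValue_mem (πref := πref) hβ hr hs
    exact abs_le.2 ⟨by linarith, h2⟩
  have hadm : ∀ τ ∈ (M.trajLaw πstar).support, M.Admissible τ := fun τ hτ =>
    (M.mem_support_trajLaw.1 hτ).1
  have href : ∀ τ ∈ (M.trajLaw πstar).support, M.prob πref τ ≠ 0 := fun τ hτ h =>
    (M.mem_support_trajLaw.1 hτ).2 ((hb τ (hadm τ hτ)).1.2 h)
  have hsoft : ∀ τ, M.Admissible τ → M.prob πref τ ≠ 0 →
      M.prob (M.softPolicy β πref) τ ≠ 0 := fun τ ha h => by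
    rw [prob_softPolicy hβ hr ha]
    exact mul_ne_zero h (Real.exp_pos _).ne'
  have hratio : ∀ τ ∈ (M.trajLaw πstar).support,
      Real.log ((M.trajLaw πstar τ).toReal / (M.trajLaw (M.softPolicy β πref) τ).toReal) =
        M.logRatio πref πstar τ - (M.reward τ - M.softValue β πref (M.initState τ)) / β := by
    intro τ hτ
    have ha := hadm τ hτ
    have h1 := (M.mem_support_trajLaw.1 hτ).2
    have h2 := href τ hτ
    have hρ : (M.ρ (M.initState τ)).toReal ≠ 0 :=
      (ENNReal.toReal_pos ((M.admissible_iff τ).1 ha).1 (M.ρ.apply_ne_top _)).ne'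
    rw [M.trajLaw_toReal ha, M.trajLaw_toReal ha, mul_div_mul_left _ _ hρ,
      ← logRatio_softPolicy hβ hr ha h2, mul_div_cancel_left₀ _ hβ.ne', logRatio, logRatio,
      Real.log_div h1 (hsoft τ ha h2), Real.log_div h1 h2, Real.log_div (hsoft τ ha h2) h2]
    ring
  have hbound : ∀ τ ∈ (M.trajLaw πstar).support,
      |(M.reward τ - M.softValue β πref (M.initState τ)) / β| ≤ Rmax / β := by
    intro τ hτ
    have ha := hadm τ hτ
    obtain ⟨h1, h2⟩ := softValue_mem (πref := πref) hβ hr ((M.admissible_iff τ).1 ha).1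
    obtain ⟨h3, h4⟩ := hr τ ha
    rw [abs_div, abs_of_pos hβ]
    exact div_le_div_of_nonneg_right (abs_le.2 ⟨by linarith, by linarith⟩) hβ.le
  have hJ := hopt (M.softPolicy β πref)
  rw [J_softPolicy hβ hr, J_eq href fun τ hτ => (hb τ (hadm τ hτ)).2, EReal.coe_le_coe_iff,
    ← M.expect_trajLaw_initState πstar hV] at hJ
  have hd : expect (M.trajLaw πstar) (fun τ => M.reward τ - β * M.logRatio πref πstar τ) =
      expect (M.trajLaw πstar) (fun τ => M.softValue β πref (M.initState τ)) -
      β * expect (M.trajLaw πstar) (fun τ => M.logRatio πref πstar τ -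
        (M.reward τ - M.softValue β πref (M.initState τ)) / β) := by
    rw [← expect_const_mul, ← expect_sub (B := Rmax) (B' := β * (B + Rmax / β))]
    · refine expect_congr fun τ _ => ?_
      field_simp
      ring
    · exact fun τ hτ => hV _ ((M.admissible_iff τ).1 (hadm τ hτ)).1
    · intro τ hτ
      rw [abs_mul, abs_of_pos hβ]
      exact mul_le_mul_of_nonneg_left ((abs_sub _ _).trans
        (add_le_add (hb τ (hadm τ hτ)).2 (hbound τ hτ))) hβ.le
  rw [hd] at hJ
  have hKL : expect (M.trajLaw πstar) (fun τ => M.logRatio πref πstar τ -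
        (M.reward τ - M.softValue β πref (M.initState τ)) / β) ≤ 0 := by
    by_contra hpos
    push Not at hpos
    nlinarith [mul_pos hβ hpos]
  rw [← expect_congr hratio] at hKL
  have heq := eq_of_expect_log_le_zero (B := B + Rmax / β)
    (fun τ hτ => M.mem_support_trajLaw.2 ⟨hadm τ hτ, hsoft τ (hadm τ hτ) (href τ hτ)⟩)
    (fun τ hτ => by
      rw [hratio τ hτ]
      exact (abs_sub _ _).trans (add_le_add (hb τ (hadm τ hτ)).2 (hbound τ hτ))) hKL τ
  have hρ : (M.ρ (M.initState τ)).toReal ≠ 0 :=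
    (ENNReal.toReal_pos ((M.admissible_iff τ).1 hτ).1 (M.ρ.apply_ne_top _)).ne'
  rw [M.trajLaw_toReal hτ, M.trajLaw_toReal hτ] at heq
  rw [← logRatio_softPolicy hβ hr hτ h0, logRatio, logRatio, mul_left_cancel₀ hρ heq]

end DCMDP

end SoftOptimal

theorem bind_congr_support {X Y : Type*} {p : PMF X} {f g : X → PMF Y}
    (h : ∀ x ∈ p.support, f x = g x) : p.bind f = p.bind g := by
  ext y
  rw [PMF.bind_apply, PMF.bind_apply]
  refine tsum_congr fun x => ?_
  by_cases hx : p x = 0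
  · simp [hx]
  · rw [h x hx]

namespace DCMDP

variable {S A : Type*} (M : DCMDP S A)

/-! ### Pairs of trajectories -/

/-- A trajectory with law `q` together with a trajectory of `πref` with the same initial state. -/
def pairLaw (πref : Policy S A) (q : PMF M.Traj) : PMF (M.Traj × M.Traj) :=
  q.bind fun τ => (M.trajLawFrom πref (M.initState τ)).map (Prod.mk τ)

theorem map_initState_trajLaw (π : Policy S A) : (M.trajLaw π).map M.initState = M.ρ := by
  rw [trajLaw, PMF.map_bind]
  conv_rhs => rw [← PMF.bind_pure M.ρ]
  refine bind_congr_support fun s _ => ?_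
  rw [← PMF.bind_pure_comp, bind_congr_support (g := fun _ => PMF.pure s) fun τ hτ => by
    rw [Function.comp_apply, M.initState_of_mem_support hτ], PMF.bind_const]

theorem pairLaw_map_fst (πref : Policy S A) (q : PMF M.Traj) :
    (M.pairLaw πref q).map Prod.fst = q := by
  rw [pairLaw, PMF.map_bind]
  conv_rhs => rw [← PMF.bind_pure q]
  refine bind_congr_support fun τ _ => ?_
  rw [PMF.map_comp, Function.comp_def]
  exact PMF.map_const _ _

theorem pairLaw_map_snd (πref π : Policy S A) :
    (M.pairLaw πref (M.trajLaw π)).map Prod.snd = M.trajLaw πref := by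
  rw [pairLaw, PMF.map_bind]
  have : (fun τ => ((M.trajLawFrom πref (M.initState τ)).map (Prod.mk τ)).map Prod.snd) =
      fun τ => M.trajLawFrom πref (M.initState τ) := by
    funext τ
    rw [PMF.map_comp, Function.comp_def]
    exact PMF.map_id _
  rw [this]
  conv_rhs => rw [trajLaw, ← M.map_initState_trajLaw π, PMF.bind_map]
  rfl

theorem pairLaw_apply (πref : Policy S A) (q : PMF M.Traj) (x : M.Traj × M.Traj) :
    M.pairLaw πref q x = q x.1 * M.trajLawFrom πref (M.initState x.1) x.2 := by
  rw [pairLaw, PMF.bind_apply, tsum_eq_single x.1]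
  · rw [PMF.map_apply, tsum_eq_single x.2]
    · simp
    · intro τ' h
      rw [if_neg]
      intro h'
      exact h (by rw [h'])
  · intro τ h
    rw [PMF.map_apply, ENNReal.tsum_eq_zero.2, mul_zero]
    intro τ'
    rw [if_neg]
    intro h'
    exact h (by rw [h'])

theorem roundLaw_eq (πref π : Policy S A) :
    M.roundLaw πref π = (M.pairLaw πref (M.trajLaw π)).bind fun x =>
      (M.bradleyTerry x.1 x.2).map fun y => ⟨x.1, x.2, y⟩ := by
  rw [roundLaw, pairLaw, trajLaw, PMF.bind_bind, PMF.bind_bind]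
  refine bind_congr_support fun s _ => ?_
  refine bind_congr_support fun τ hτ => ?_
  rw [M.initState_of_mem_support hτ, PMF.bind_map]
  rfl

variable {M} {πref πstar : Policy S A} {β Rmax Vmax : ℝ} {Pi : Finset (Policy S A)}

theorem mem_support_of_mem_support_pairLaw {q : PMF M.Traj}
    (hq : q.support ⊆ (M.trajLaw πref).support) {x : M.Traj × M.Traj}
    (hx : x ∈ (M.pairLaw πref q).support) :
    x.1 ∈ (M.trajLaw πref).support ∧ x.2 ∈ (M.trajLaw πref).support ∧
      M.initState x.1 = M.initState x.2 := by
  rw [PMF.mem_support_iff, pairLaw_apply] at hx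
  have h1 := hq (show x.1 ∈ q.support from left_ne_zero_of_mul hx)
  have h2 : x.2 ∈ (M.trajLawFrom πref (M.initState x.1)).support := right_ne_zero_of_mul hx
  have h3 := M.initState_of_mem_support h2
  refine ⟨h1, ?_, h3.symm⟩
  rw [PMF.mem_support_iff, trajLaw_apply, h3]
  exact mul_ne_zero ((M.admissible_iff _).1 (M.mem_support_trajLaw.1 h1).1).1 h2

theorem BoundedRatios.support_subset (hb : M.BoundedRatios πref β Vmax Pi) {π : Policy S A}
    (hπ : π ∈ Pi) : (M.trajLaw π).support ⊆ (M.trajLaw πref).support := by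
  intro τ hτ
  rw [mem_support_trajLaw] at hτ ⊢
  exact ⟨hτ.1, fun h => hτ.2 ((hb π hπ τ hτ.1).1.2 h)⟩

theorem BoundedRatios.prob_ne_zero (hb : M.BoundedRatios πref β Vmax Pi) {π : Policy S A}
    (hπ : π ∈ Pi) {τ : M.Traj} (hτ : τ ∈ (M.trajLaw πref).support) : M.prob π τ ≠ 0 := by
  rw [mem_support_trajLaw] at hτ
  exact fun h => hτ.2 ((hb π hπ τ hτ.1).1.1 h)

theorem BoundedRatios.abs_le (hβ : 0 < β) (hb : M.BoundedRatios πref β Vmax Pi) {π : Policy S A}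
    (hπ : π ∈ Pi) {τ : M.Traj} (hτ : τ ∈ (M.trajLaw πref).support) :
    |β * M.logRatio πref π τ| ≤ Vmax := by
  rw [abs_mul, abs_of_pos hβ, mul_comm, ← le_div_iff₀ hβ]
  exact (hb π hπ τ (M.mem_support_trajLaw.1 hτ).1).2

theorem BoundedRatios.Vmax_nonneg (hβ : 0 < β) (hb : M.BoundedRatios πref β Vmax Pi)
    {π : Policy S A} (hπ : π ∈ Pi) : 0 ≤ Vmax := by
  obtain ⟨τ, hτ⟩ := (M.trajLaw πref).support_nonempty
  exact (abs_nonneg _).trans (hb.abs_le hβ hπ hτ)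

variable (M)

/-- The logit of the preference that is modelled by `π`. -/
def logit (πref : Policy S A) (β : ℝ) (π : Policy S A) (x : M.Traj × M.Traj) : ℝ :=
  β * M.logRatio πref π x.1 - β * M.logRatio πref π x.2

/-- The logit of the Bradley-Terry preference. -/
def rewardGap (x : M.Traj × M.Traj) : ℝ := M.reward x.1 - M.reward x.2

/-- The expected log-ratio between `π` and `πstar` under the reference policy. -/
def logGap (πref πstar π : Policy S A) : ℝ :=
  expect (M.trajLaw πref) fun τ => Real.log (M.prob π τ) - Real.log (M.prob πstar τ)

/-- The value of the objective as a real number. -/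
def value (πref : Policy S A) (β : ℝ) (π : Policy S A) : ℝ :=
  expect (M.trajLaw π) fun τ => M.reward τ - β * M.logRatio πref π τ

/-- The expected squared Hellinger distance between the preference models of `π` and `πstar` when
`p` and the reference policy generate the responses. -/
def expectHellinger (πref πstar : Policy S A) (β : ℝ) (π p : Policy S A) : ℝ :=
  expect (M.pairLaw πref (M.trajLaw p)) fun x =>
    hellinger (M.logit πref β π x) (M.logit πref β πstar x)

variable {M}

theorem abs_rewardGap_le
    (hr : ∀ τ : M.Traj, M.Admissible τ → 0 ≤ M.reward τ ∧ M.reward τ ≤ Rmax)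
    {x : M.Traj × M.Traj} (h1 : x.1 ∈ (M.trajLaw πref).support)
    (h2 : x.2 ∈ (M.trajLaw πref).support) : |M.rewardGap x| ≤ Rmax := by
  have a1 := hr _ (M.mem_support_trajLaw.1 h1).1
  have a2 := hr _ (M.mem_support_trajLaw.1 h2).1
  rw [rewardGap]
  exact _root_.abs_le.2 ⟨by linarith, by linarith⟩

theorem abs_logit_sub_rewardGap_le (hβ : 0 < β)
    (hr : ∀ τ : M.Traj, M.Admissible τ → 0 ≤ M.reward τ ∧ M.reward τ ≤ Rmax)
    (hb : M.BoundedRatios πref β Vmax Pi) {π : Policy S A} (hπ : π ∈ Pi)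
    {x : M.Traj × M.Traj} (h1 : x.1 ∈ (M.trajLaw πref).support)
    (h2 : x.2 ∈ (M.trajLaw πref).support) :
    |M.logit πref β π x - M.rewardGap x| ≤ 2 * Vmax + Rmax := by
  have a1 := hb.abs_le hβ hπ h1
  have a2 := hb.abs_le hβ hπ h2
  have a3 := abs_rewardGap_le hr h1 h2
  rw [logit]
  rw [_root_.abs_le] at *
  exact ⟨by linarith, by linarith⟩

theorem logit_optimal (hβ : 0 < β)
    (hr : ∀ τ : M.Traj, M.Admissible τ → 0 ≤ M.reward τ ∧ M.reward τ ≤ Rmax)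
    (hb : M.BoundedRatios πref β Vmax Pi) (hstar : πstar ∈ Pi)
    (hopt : M.IsOptimal πref β πstar) {x : M.Traj × M.Traj}
    (h1 : x.1 ∈ (M.trajLaw πref).support)
    (h2 : x.2 ∈ (M.trajLaw πref).support) (h3 : M.initState x.1 = M.initState x.2) :
    M.logit πref β πstar x = M.rewardGap x := by
  rw [mem_support_trajLaw] at h1 h2
  rw [logit, hopt.logRatio_eq hβ hr (hb πstar hstar) h1.1 h1.2,
    hopt.logRatio_eq hβ hr (hb πstar hstar) h2.1 h2.2, h3, rewardGap]
  ring

theorem abs_log_sub_log_le (hb : M.BoundedRatios πref β Vmax Pi)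
    (hstar : πstar ∈ Pi) {π : Policy S A} (hπ : π ∈ Pi) {τ : M.Traj}
    (hτ : τ ∈ (M.trajLaw πref).support) :
    |Real.log (M.prob π τ) - Real.log (M.prob πstar τ)| ≤ 2 * Vmax / β := by
  have h0 := (M.mem_support_trajLaw.1 hτ).2
  have h1 := (hb π hπ τ (M.mem_support_trajLaw.1 hτ).1).2
  have h2 := (hb πstar hstar τ (M.mem_support_trajLaw.1 hτ).1).2
  rw [logRatio, Real.log_div (hb.prob_ne_zero hπ hτ) h0] at h1
  rw [logRatio, Real.log_div (hb.prob_ne_zero hstar hτ) h0] at h2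
  rw [mul_div_assoc]
  rw [_root_.abs_le] at *
  exact ⟨by linarith, by linarith⟩

theorem J_eq_value (hb : M.BoundedRatios πref β Vmax Pi) {π : Policy S A} (hπ : π ∈ Pi) :
    M.J πref β π = (M.value πref β π : EReal) :=
  J_eq (fun _ hτ => (M.mem_support_trajLaw.1 (hb.support_subset hπ hτ)).2)
    fun τ hτ => (hb π hπ τ (M.mem_support_trajLaw.1 hτ).1).2

/-- The regret decomposes into the estimation error of the implicit reward under `π` and the
log-ratio between `π` and `πstar` under the reference policy. -/
theorem regret_eq (hβ : 0 < β)
    (hr : ∀ τ : M.Traj, M.Admissible τ → 0 ≤ M.reward τ ∧ M.reward τ ≤ Rmax)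
    (hb : M.BoundedRatios πref β Vmax Pi) (hstar : πstar ∈ Pi)
    (hopt : M.IsOptimal πref β πstar) {π : Policy S A} (hπ : π ∈ Pi) :
    M.value πref β πstar - M.value πref β π =
      expect (M.pairLaw πref (M.trajLaw π)) (fun x => M.logit πref β π x - M.rewardGap x) +
        β * M.logGap πref πstar π := by
  have hV : ∀ s ∈ M.ρ.support, |M.softValue β πref s| ≤ Rmax := by
    intro s hs
    obtain ⟨h1, h2⟩ := softValue_mem (πref := πref) hβ hr hs
    exact _root_.abs_le.2 ⟨by linarith, h2⟩
  have hf : ∀ p ∈ Pi, ∀ τ ∈ (M.trajLaw πref).support,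
      |M.reward τ - β * M.logRatio πref p τ| ≤ Rmax + Vmax := by
    intro p hp τ hτ
    have h1 := hb.abs_le hβ hp hτ
    have h2 := hr τ (M.mem_support_trajLaw.1 hτ).1
    rw [_root_.abs_le] at *
    exact ⟨by linarith, by linarith⟩
  have hstar' : ∀ τ ∈ (M.trajLaw πref).support,
      M.reward τ - β * M.logRatio πref πstar τ = M.softValue β πref (M.initState τ) := by
    intro τ hτ
    rw [mem_support_trajLaw] at hτ
    rw [hopt.logRatio_eq hβ hr (hb πstar hstar) hτ.1 hτ.2]
    ring
  have h1 : M.value πref β πstar =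
      expect (M.trajLaw πref) (fun τ => M.reward τ - β * M.logRatio πref πstar τ) := by
    rw [value, expect_congr fun τ hτ => hstar' τ (hb.support_subset hstar hτ),
      expect_congr hstar', M.expect_trajLaw_initState _ hV, M.expect_trajLaw_initState _ hV]
  have hpair : ∀ x ∈ (M.pairLaw πref (M.trajLaw π)).support,
      x.1 ∈ (M.trajLaw πref).support ∧ x.2 ∈ (M.trajLaw πref).support ∧
        M.initState x.1 = M.initState x.2 := fun x hx =>
    mem_support_of_mem_support_pairLaw (hb.support_subset hπ) hx
  have h2 : M.value πref β π = expect (M.pairLaw πref (M.trajLaw π))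
      (fun x => M.reward x.1 - β * M.logRatio πref π x.1) := by
    rw [value]
    conv_lhs => rw [← M.pairLaw_map_fst πref (M.trajLaw π)]
    exact expect_map fun x hx => hf π hπ _ (hpair x hx).1
  have h3 : expect (M.trajLaw πref) (fun τ => M.reward τ - β * M.logRatio πref π τ) =
      expect (M.pairLaw πref (M.trajLaw π))
        (fun x => M.reward x.2 - β * M.logRatio πref π x.2) := by
    conv_lhs => rw [← M.pairLaw_map_snd πref π]
    exact expect_map fun x hx => hf π hπ _ (hpair x hx).2.1
  have h4 : β * M.logGap πref πstar π =
      expect (M.trajLaw πref) (fun τ => M.reward τ - β * M.logRatio πref πstar τ) -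
        expect (M.trajLaw πref) (fun τ => M.reward τ - β * M.logRatio πref π τ) := by
    rw [logGap, ← expect_const_mul, ← expect_sub (hf πstar hstar) (hf π hπ)]
    refine expect_congr fun τ hτ => ?_
    have h0 := (M.mem_support_trajLaw.1 hτ).2
    rw [logRatio, logRatio, Real.log_div (hb.prob_ne_zero hπ hτ) h0,
      Real.log_div (hb.prob_ne_zero hstar hτ) h0]
    ring
  have h5 : expect (M.pairLaw πref (M.trajLaw π)) (fun x => M.logit πref β π x - M.rewardGap x) =
      expect (M.pairLaw πref (M.trajLaw π))
        (fun x => M.reward x.2 - β * M.logRatio πref π x.2) -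
      expect (M.pairLaw πref (M.trajLaw π))
        (fun x => M.reward x.1 - β * M.logRatio πref π x.1) := by
    rw [← expect_sub (fun x hx => hf π hπ _ (hpair x hx).2.1)
      (fun x hx => hf π hπ _ (hpair x hx).1)]
    refine expect_congr fun x _ => ?_
    rw [logit, rewardGap]
    ring
  rw [h5, h4, h1, h2, h3]
  ring

/-! ### Exponential moments of one round -/

theorem mul_exp_half_log_sub {u v : ℝ} (hu : 0 < u) (hv : 0 < v) :
    v * Real.exp ((Real.log u - Real.log v) / 2) = √(u * v) := by
  have h : (v * Real.exp ((Real.log u - Real.log v) / 2)) ^ 2 = u * v := by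
    rw [mul_pow, ← Real.exp_nat_mul, Nat.cast_ofNat, mul_div_cancel₀ _ two_ne_zero, Real.exp_sub,
      Real.exp_log hu, Real.exp_log hv]
    field_simp
  rw [← h, Real.sqrt_sq (by positivity)]

theorem bradleyTerry_true (τ τ' : M.Traj) :
    M.bradleyTerry τ τ' true = ENNReal.ofReal (Real.sigmoid (M.reward τ - M.reward τ')) := by
  rw [bradleyTerry, PMF.ofFintype_apply, if_pos rfl, Real.sigmoid_def, neg_sub, Real.exp_sub]
  congr 1
  field_simp

theorem bradleyTerry_false (τ τ' : M.Traj) :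
    M.bradleyTerry τ τ' false = ENNReal.ofReal (Real.sigmoid (-(M.reward τ - M.reward τ'))) := by
  rw [bradleyTerry, PMF.ofFintype_apply, if_neg (by simp), Real.sigmoid_def, neg_neg, Real.exp_sub]
  congr 1
  field_simp
  ring

/-- Half of the log-likelihood ratio of the preference models of `π` and `πstar` in one round. -/
def halfLogLikelihood (πref πstar : Policy S A) (β : ℝ) (π : Policy S A) (z : M.Sample) : ℝ :=
  (Real.log (Real.sigmoid (M.logit πref β π (z.pos, z.neg))) -
    Real.log (Real.sigmoid (M.logit πref β πstar (z.pos, z.neg)))) / 2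

theorem lexpect_bradleyTerry {x : M.Traj × M.Traj} (π : Policy S A)
    (hx : M.logit πref β πstar x = M.rewardGap x) :
    lexpect ((M.bradleyTerry x.1 x.2).map fun y => (⟨x.1, x.2, y⟩ : M.Sample))
        (fun z => ENNReal.ofReal (Real.exp (halfLogLikelihood πref πstar β π z))) =
      ENNReal.ofReal (1 - hellinger (M.logit πref β π x) (M.logit πref β πstar x)) := by
  rw [lexpect_map, lexpect, tsum_bool, bradleyTerry_true, bradleyTerry_false]
  have hswap : ∀ p : Policy S A, M.logit πref β p (x.2, x.1) = -M.logit πref β p x := fun p => by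
    rw [logit, logit]; ring
  simp only [Function.comp_apply, halfLogLikelihood, Sample.pos, Sample.neg, if_true,
    Bool.false_eq_true, if_false, hswap]
  rw [show M.reward x.1 - M.reward x.2 = M.logit πref β πstar x from hx.symm,
    ← ENNReal.ofReal_mul (Real.sigmoid_nonneg _), ← ENNReal.ofReal_mul (Real.sigmoid_nonneg _),
    mul_exp_half_log_sub (Real.sigmoid_pos _) (Real.sigmoid_pos _),
    mul_exp_half_log_sub (Real.sigmoid_pos _) (Real.sigmoid_pos _),
    ← ENNReal.ofReal_add (Real.sqrt_nonneg _) (Real.sqrt_nonneg _), hellinger]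
  congr 1
  ring

theorem lexpect_exp_halfLogLikelihood_le (hβ : 0 < β)
    (hr : ∀ τ : M.Traj, M.Admissible τ → 0 ≤ M.reward τ ∧ M.reward τ ≤ Rmax)
    (hb : M.BoundedRatios πref β Vmax Pi) (hstar : πstar ∈ Pi)
    (hopt : M.IsOptimal πref β πstar) (π : Policy S A) {p : Policy S A}
    (hp : (M.trajLaw p).support ⊆ (M.trajLaw πref).support) :
    lexpect (M.roundLaw πref p)
        (fun z => ENNReal.ofReal (Real.exp (halfLogLikelihood πref πstar β π z))) ≤
      ENNReal.ofReal (Real.exp (-M.expectHellinger πref πstar β π p)) := by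
  have hbd : ∀ x ∈ (M.pairLaw πref (M.trajLaw p)).support,
      |hellinger (M.logit πref β π x) (M.logit πref β πstar x)| ≤ 1 := fun x _ => by
    rw [abs_of_nonneg (hellinger_nonneg _ _)]
    exact hellinger_le_one _ _
  rw [roundLaw_eq, lexpect_bind, lexpect_congr fun x hx => by
    obtain ⟨h1, h2, h3⟩ := mem_support_of_mem_support_pairLaw hp hx
    exact lexpect_bradleyTerry π (logit_optimal hβ hr hb hstar hopt h1 h2 h3)]
  rw [← ofReal_expect (B := 1)]
  · refine ENNReal.ofReal_le_ofReal ?_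
    rw [expect_sub (B := 1) (fun _ _ => by simp) hbd, expect_const]
    have := Real.add_one_le_exp (-M.expectHellinger πref πstar β π p)
    rw [expectHellinger] at *
    linarith
  · intro x _
    have h1 := hellinger_nonneg (M.logit πref β π x) (M.logit πref β πstar x)
    have h2 := hellinger_le_one (M.logit πref β π x) (M.logit πref β πstar x)
    exact _root_.abs_le.2 ⟨by linarith, by linarith⟩
  · intro x _
    linarith [hellinger_le_one (M.logit πref β π x) (M.logit πref β πstar x)]

theorem lexpect_roundLaw_snd (πref p : Policy S A) (f : M.Traj → ℝ≥0∞) :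
    lexpect (M.roundLaw πref p) (fun z => f z.τ') = lexpect (M.trajLaw πref) f := by
  rw [roundLaw_eq, lexpect_bind]
  conv_rhs => rw [← M.pairLaw_map_snd πref p, lexpect_map]
  refine lexpect_congr fun x _ => ?_
  rw [lexpect_map]
  exact lexpect_const (M.bradleyTerry x.1 x.2) (f x.2)

theorem lexpect_exp_logGap_le (hb : M.BoundedRatios πref β Vmax Pi)
    (hstar : πstar ∈ Pi) {π : Policy S A} (hπ : π ∈ Pi) (p : Policy S A) (l : ℝ) :
    lexpect (M.roundLaw πref p) (fun z => ENNReal.ofReal (Real.exp (l *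
        (Real.log (M.prob π z.τ') - Real.log (M.prob πstar z.τ') - M.logGap πref πstar π)))) ≤
      ENNReal.ofReal (Real.exp ((2 * Vmax / β) ^ 2 * l ^ 2 / 2)) := by
  rw [lexpect_roundLaw_snd πref p fun τ => ENNReal.ofReal (Real.exp (l *
    (Real.log (M.prob π τ) - Real.log (M.prob πstar τ) - M.logGap πref πstar π)))]
  exact lexpect_exp_le (fun τ hτ => abs_log_sub_log_le hb hstar hπ hτ) l

/-- The part of the potential that is observed in a round. -/
def observedTerm (πref πstar : Policy S A) (β α : ℝ) (π : Policy S A) (z : M.Sample) : ℝ :=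
  (halfLogLikelihood πref πstar β π z -
    α / 2 * (Real.log (M.prob π z.τ') - Real.log (M.prob πstar z.τ'))) / 2

variable (M) in
/-- The compensator of `observedTerm` when `p` is played. -/
def compensator (πref πstar : Policy S A) (β Vmax α : ℝ) (π p : Policy S A) : ℝ :=
  (M.expectHellinger πref πstar β π p + α / 2 * M.logGap πref πstar π -
    (2 * Vmax / β) ^ 2 * (α / 2) ^ 2 / 2) / 2

theorem exp_half_add_le (u v : ℝ) : Real.exp ((u + v) / 2) ≤ (Real.exp u + Real.exp v) / 2 := by
  have hu : Real.exp u = Real.exp (u / 2) ^ 2 := by rw [← Real.exp_nat_mul]; ring_nf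
  have hv : Real.exp v = Real.exp (v / 2) ^ 2 := by rw [← Real.exp_nat_mul]; ring_nf
  rw [add_div, Real.exp_add, hu, hv]
  nlinarith [sq_nonneg (Real.exp (u / 2) - Real.exp (v / 2))]

theorem lexpect_exp_add_le_one {X : Type*} {p : PMF X} {f : X → ℝ} {a : ℝ}
    (h : lexpect p (fun x => ENNReal.ofReal (Real.exp (f x))) ≤ ENNReal.ofReal (Real.exp (-a))) :
    lexpect p (fun x => ENNReal.ofReal (Real.exp (f x + a))) ≤ 1 := by
  simp_rw [Real.exp_add, mul_comm _ (Real.exp a), ENNReal.ofReal_mul (Real.exp_pos a).le]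
  rw [lexpect_const_mul]
  calc _ ≤ ENNReal.ofReal (Real.exp a) * ENNReal.ofReal (Real.exp (-a)) := by gcongr
    _ = 1 := by
      rw [← ENNReal.ofReal_mul (Real.exp_pos a).le, ← Real.exp_add, add_neg_cancel, Real.exp_zero,
        ENNReal.ofReal_one]

theorem lexpect_exp_observedTerm_le_one (hβ : 0 < β)
    (hr : ∀ τ : M.Traj, M.Admissible τ → 0 ≤ M.reward τ ∧ M.reward τ ≤ Rmax)
    (hb : M.BoundedRatios πref β Vmax Pi) (hstar : πstar ∈ Pi)
    (hopt : M.IsOptimal πref β πstar) (α : ℝ) {π : Policy S A} (hπ : π ∈ Pi) {p : Policy S A}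
    (hp : (M.trajLaw p).support ⊆ (M.trajLaw πref).support) :
    lexpect (M.roundLaw πref p) (fun z => ENNReal.ofReal (Real.exp
      (observedTerm πref πstar β α π z + M.compensator πref πstar β Vmax α π p))) ≤ 1 := by
  have h1 := lexpect_exp_add_le_one
    (lexpect_exp_halfLogLikelihood_le hβ hr hb hstar hopt π hp)
  have h2 := lexpect_exp_logGap_le hb hstar hπ p (-(α / 2))
  rw [← neg_neg ((2 * Vmax / β) ^ 2 * (-(α / 2)) ^ 2 / 2)] at h2
  have h2 := lexpect_exp_add_le_one h2
  have h3 : ENNReal.ofReal (1 / 2) * 1 + ENNReal.ofReal (1 / 2) * 1 = 1 := by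
    rw [mul_one, ← ENNReal.ofReal_add (by norm_num) (by norm_num)]
    norm_num
  rw [← h3]
  refine le_trans ?_ (add_le_add (mul_le_mul_right h1 (ENNReal.ofReal (1 / 2)))
    (mul_le_mul_right h2 (ENNReal.ofReal (1 / 2))))
  rw [← lexpect_const_mul, ← lexpect_const_mul, ← lexpect_add]
  refine lexpect_mono fun z _ => ?_
  rw [← ENNReal.ofReal_mul (by norm_num), ← ENNReal.ofReal_mul (by norm_num),
    ← ENNReal.ofReal_add (by positivity) (by positivity)]
  refine ENNReal.ofReal_le_ofReal ?_
  refine le_trans (le_of_eq ?_) ((exp_half_add_le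
    (halfLogLikelihood πref πstar β π z + M.expectHellinger πref πstar β π p)
    (-(α / 2) * (Real.log (M.prob π z.τ') - Real.log (M.prob πstar z.τ') -
      M.logGap πref πstar π) + -((2 * Vmax / β) ^ 2 * (-(α / 2)) ^ 2 / 2))).trans
    (le_of_eq (by ring)))
  rw [observedTerm, compensator]
  congr 1
  ring

end DCMDP

namespace DCMDP

variable {S A : Type*} {M : DCMDP S A}

/-! ### Uniform concentration over the rounds -/

section Concentration

variable (πref : Policy S A) (upd : List M.Sample → Policy S A)

theorem length_of_mem_support_dataLaw {t : ℕ} {D : List M.Sample}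
    (h : D ∈ (dataLaw πref upd t).support) : D.length = t := by
  induction t generalizing D with
  | zero =>
    rw [dataLaw, PMF.mem_support_pure_iff] at h
    rw [h, List.length_nil]
  | succ t ih =>
    rw [dataLaw, PMF.mem_support_bind_iff] at h
    obtain ⟨D', hD', h⟩ := h
    rw [PMF.mem_support_map_iff] at h
    obtain ⟨z, _, rfl⟩ := h
    rw [List.length_append, ih hD', List.length_singleton]

/-- The sum of the observed terms `φ` and the compensators `κ` along the data. -/
def process (φ : M.Sample → ℝ) (κ : Policy S A → ℝ) (D : List M.Sample) : ℝ :=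
  (D.map φ).sum + ∑ j ∈ Finset.range D.length, κ (current πref upd (D.take j))

variable {πref upd}

theorem process_append (φ : M.Sample → ℝ) (κ : Policy S A → ℝ) (D : List M.Sample)
    (z : M.Sample) : process πref upd φ κ (D ++ [z]) =
      process πref upd φ κ D + (φ z + κ (current πref upd D)) := by
  rw [process, process, List.map_append, List.sum_append, List.length_append,
    List.length_singleton, Finset.sum_range_succ, List.take_left]
  have : ∑ j ∈ Finset.range D.length, κ (current πref upd ((D ++ [z]).take j)) =
      ∑ j ∈ Finset.range D.length, κ (current πref upd (D.take j)) :=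
    Finset.sum_congr rfl fun j hj => by
      rw [List.take_append_of_le_length (Finset.mem_range.1 hj).le]
  rw [this]
  simp only [List.map_cons, List.map_nil, List.sum_cons, List.sum_nil]
  ring

theorem lexpect_exp_process_le_one {φ : M.Sample → ℝ} {κ : Policy S A → ℝ}
    (h : ∀ D : List M.Sample, lexpect (M.roundLaw πref (current πref upd D))
      (fun z => ENNReal.ofReal (Real.exp (φ z + κ (current πref upd D)))) ≤ 1) (t : ℕ) :
    lexpect (dataLaw πref upd t)
      (fun D => ENNReal.ofReal (Real.exp (process πref upd φ κ D))) ≤ 1 := by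
  induction t with
  | zero => simp [dataLaw, lexpect_pure, process]
  | succ t ih =>
    rw [dataLaw, lexpect_bind]
    refine le_trans (lexpect_mono fun D _ => ?_) ih
    rw [lexpect_map]
    simp only [Function.comp_def, process_append]
    simp_rw [Real.exp_add (process πref upd φ κ D), ENNReal.ofReal_mul (Real.exp_pos _).le]
    rw [lexpect_const_mul]
    exact mul_le_of_le_one_right' (h D)

theorem lexpect_indicator_process_le {φ : M.Sample → ℝ} {κ : Policy S A → ℝ}
    (h : ∀ D : List M.Sample, lexpect (M.roundLaw πref (current πref upd D))
      (fun z => ENNReal.ofReal (Real.exp (φ z + κ (current πref upd D)))) ≤ 1) (t : ℕ) (l : ℝ) :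
    lexpect (dataLaw πref upd t) ({D | l < process πref upd φ κ D}.indicator 1) ≤
      ENNReal.ofReal (Real.exp (-l)) := by
  calc _ ≤ lexpect (dataLaw πref upd t) (fun D => ENNReal.ofReal (Real.exp (-l)) *
        ENNReal.ofReal (Real.exp (process πref upd φ κ D))) := by
        refine lexpect_mono fun D _ => ?_
        by_cases hD : l < process πref upd φ κ D
        swap
        · rw [Set.indicator_of_notMem (by exact hD)]
          exact zero_le
        rw [Set.indicator_of_mem (by exact hD), ← ENNReal.ofReal_mul (Real.exp_pos _).le,
          ← Real.exp_add, Pi.one_apply,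
          ENNReal.one_le_ofReal, Real.one_le_exp_iff]
        linarith
    _ ≤ _ := by
        rw [lexpect_const_mul]
        exact mul_le_of_le_one_right' (lexpect_exp_process_le_one h t)

/-- A union bound over the members of a finite family of processes and over the rounds. -/
theorem lexpect_exists_process_le {ι : Type*} (I : Finset ι) {φ : ι → M.Sample → ℝ}
    {κ : ι → Policy S A → ℝ}
    (h : ∀ i ∈ I, ∀ D : List M.Sample, lexpect (M.roundLaw πref (current πref upd D))
      (fun z => ENNReal.ofReal (Real.exp (φ i z + κ i (current πref upd D)))) ≤ 1)
    (l : ℝ) (T : ℕ) :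
    lexpect (dataLaw πref upd T) ({D | ∃ t, 1 ≤ t ∧ t ≤ T ∧ ∃ i ∈ I,
        l < process πref upd (φ i) (κ i) (D.take t)}.indicator 1) ≤
      T * (I.card * ENNReal.ofReal (Real.exp (-l))) := by
  induction T with
  | zero =>
    refine le_of_eq_of_le ?_ zero_le
    refine ENNReal.tsum_eq_zero.2 fun D => ?_
    rw [Set.indicator_of_notMem, mul_zero]
    rintro ⟨t, h1, h2, _⟩
    omega
  | succ T ih =>
    have hsplit : ∀ D ∈ (dataLaw πref upd T).support, ∀ z : M.Sample,
        ({D | ∃ t, 1 ≤ t ∧ t ≤ T + 1 ∧ ∃ i ∈ I,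
          l < process πref upd (φ i) (κ i) (D.take t)}.indicator 1 (D ++ [z]) : ℝ≥0∞) ≤
        {D | ∃ t, 1 ≤ t ∧ t ≤ T ∧ ∃ i ∈ I,
          l < process πref upd (φ i) (κ i) (D.take t)}.indicator 1 D +
        ∑ i ∈ I, {D | l < process πref upd (φ i) (κ i) D}.indicator 1 (D ++ [z]) := by
      intro D hD z
      have hlen := length_of_mem_support_dataLaw πref upd hD
      by_cases hbad : ∃ t, 1 ≤ t ∧ t ≤ T + 1 ∧ ∃ i ∈ I,
          l < process πref upd (φ i) (κ i) ((D ++ [z]).take t)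
      swap
      · rw [Set.indicator_of_notMem (by exact hbad)]
        exact zero_le
      rw [Set.indicator_of_mem (by exact hbad), Pi.one_apply]
      obtain ⟨t, h1, h2, i, hi, hlt⟩ := hbad
      rcases h2.lt_or_eq with h3 | rfl
      · refine le_add_right (le_of_eq ?_)
        rw [Set.indicator_of_mem, Pi.one_apply]
        refine ⟨t, h1, by omega, i, hi, ?_⟩
        rwa [List.take_append_of_le_length (by omega)] at hlt
      · rw [List.take_of_length_le (by simp [hlen])] at hlt
        refine le_add_left (le_trans (le_of_eq ?_) (Finset.single_le_sum
          (fun _ _ => zero_le) hi))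
        rw [Set.indicator_of_mem (by exact hlt), Pi.one_apply]
    have hbind : ∀ f : List M.Sample → ℝ≥0∞, lexpect (dataLaw πref upd (T + 1)) f =
        lexpect (dataLaw πref upd T) fun D =>
          lexpect (M.roundLaw πref (current πref upd D)) fun z => f (D ++ [z]) := by
      intro f
      rw [dataLaw, lexpect_bind]
      refine lexpect_congr fun D _ => ?_
      rw [lexpect_map]
      rfl
    rw [hbind]
    refine (lexpect_mono fun D hD => lexpect_mono fun z _ => hsplit D hD z).trans ?_
    simp_rw [lexpect_add, lexpect_const, lexpect_finsetSum]
    rw [Nat.cast_add, add_mul, Nat.cast_one, one_mul]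
    refine add_le_add ih ?_
    rw [← nsmul_eq_mul]
    refine Finset.sum_le_card_nsmul _ _ _ fun i hi => ?_
    rw [← hbind]
    exact lexpect_indicator_process_le (h i hi) (T + 1) l

end Concentration

/-! ### Coverability -/

section Coverability

variable {Pi : Finset (Policy S A)}

theorem one_le_coverability {π : Policy S A} (hπ : π ∈ Pi) : 1 ≤ M.coverability Pi := by
  refine le_iInf fun μ => ?_
  set K := ⨆ τ : M.Traj, ⨆ π ∈ Pi, M.trajLaw π τ / μ τ with hK
  by_cases hKtop : K = ⊤
  · simp [hKtop]
  have hle : ∀ τ, M.trajLaw π τ ≤ K * μ τ := by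
    intro τ
    have h1 : M.trajLaw π τ / μ τ ≤ K :=
      (le_iSup₂_of_le (f := fun π (_ : π ∈ Pi) => M.trajLaw π τ / μ τ) π hπ le_rfl).trans
        (le_iSup (fun τ => ⨆ π ∈ Pi, M.trajLaw π τ / μ τ) τ)
    exact (ENNReal.div_le_iff_le_mul (Or.inr hKtop) (Or.inl (μ.apply_ne_top τ))).1 h1
  calc (1 : ℝ≥0∞) = ∑' τ, M.trajLaw π τ := (M.trajLaw π).tsum_coe.symm
    _ ≤ ∑' τ, K * μ τ := ENNReal.tsum_le_tsum hle
    _ = K := by rw [ENNReal.tsum_mul_left, μ.tsum_coe, mul_one]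

theorem coverability_ne_top (hne : Pi.Nonempty) : M.coverability Pi ≠ ⊤ := by
  refine ne_top_of_le_ne_top (ENNReal.natCast_ne_top Pi.card) ?_
  refine iInf_le_of_le ((PMF.uniformOfFinset Pi hne).bind M.trajLaw) ?_
  refine iSup_le fun τ => iSup₂_le fun π hπ => ENNReal.div_le_of_le_mul ?_
  have hcard : (Pi.card : ℝ≥0∞) ≠ 0 := by exact_mod_cast hne.card_ne_zero
  calc M.trajLaw π τ = Pi.card * ((PMF.uniformOfFinset Pi hne) π * M.trajLaw π τ) := by
        rw [PMF.uniformOfFinset_apply_of_mem _ hπ, ← mul_assoc,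
          ENNReal.mul_inv_cancel hcard (ENNReal.natCast_ne_top _), one_mul]
    _ ≤ _ := by
        gcongr
        rw [PMF.bind_apply]
        exact ENNReal.le_tsum π

theorem one_le_toReal_coverability {π : Policy S A} (hπ : π ∈ Pi) :
    1 ≤ (M.coverability Pi).toReal := by
  simpa using ENNReal.toReal_mono (coverability_ne_top ⟨π, hπ⟩) (one_le_coverability (M := M) hπ)

theorem exists_covering (hne : Pi.Nonempty) :
    ∃ μ : PMF M.Traj, ∀ π ∈ Pi, ∀ τ,
      (M.trajLaw π τ).toReal ≤ 2 * (M.coverability Pi).toReal * (μ τ).toReal := by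
  obtain ⟨π₀, h₀⟩ := hne
  have htop := coverability_ne_top (M := M) ⟨π₀, h₀⟩
  have hpos : M.coverability Pi ≠ 0 :=
    (zero_lt_one.trans_le (one_le_coverability (M := M) h₀)).ne'
  have hlt : M.coverability Pi < 2 * M.coverability Pi := by
    rw [two_mul]
    exact ENNReal.lt_add_right htop hpos
  have htop' : 2 * M.coverability Pi ≠ ⊤ := ENNReal.mul_ne_top ENNReal.ofNat_ne_top htop
  obtain ⟨μ, hμ⟩ := iInf_lt_iff.1 (show (⨅ μ : PMF M.Traj, ⨆ τ : M.Traj, ⨆ π ∈ Pi,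
    M.trajLaw π τ / μ τ) < 2 * M.coverability Pi from hlt)
  refine ⟨μ, fun π hπ τ => ?_⟩
  have h1 : M.trajLaw π τ / μ τ ≤ 2 * M.coverability Pi :=
    (le_iSup₂_of_le (f := fun π (_ : π ∈ Pi) => M.trajLaw π τ / μ τ) π hπ le_rfl).trans
      ((le_iSup (fun τ => ⨆ π ∈ Pi, M.trajLaw π τ / μ τ) τ).trans hμ.le)
  have h2 := (ENNReal.div_le_iff_le_mul (Or.inr htop') (Or.inl (μ.apply_ne_top τ))).1 h1
  have h3 := ENNReal.toReal_mono (ENNReal.mul_ne_top htop' (μ.apply_ne_top τ)) h2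
  simpa [ENNReal.toReal_mul] using h3

end Coverability

end DCMDP

/-! ### Averaging the regret -/

theorem sum_inv_succ_le (T : ℕ) :
    ∑ t ∈ Finset.range T, ((t : ℝ) + 1)⁻¹ ≤ 1 + Real.log T := by
  have h := harmonic_le_one_add_log T
  rw [harmonic] at h
  push_cast at h
  exact h

theorem half_le_log_two : (1 : ℝ) / 2 ≤ Real.log 2 := by
  linarith [Real.log_two_gt_d9]

theorem sqrt_div_eq {L U : ℝ} (hU : 0 < U) : √(L / U) = √(U * L) / U := by
  have : L / U = U * L / U ^ 2 := by field_simp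
  rw [this, Real.sqrt_div' _ (sq_nonneg U), Real.sqrt_sq hU.le]

/-- If the regrets are controlled by a summable potential and by a harmonic term, one of them is
small. -/
theorem exists_regret_le {T : ℕ} (hT : 2 ≤ T) {c B L K α β c' : ℝ} (hc : 0 < c) (hB : 0 < B)
    (hL : Real.log 2 ≤ L) (hK : 1 ≤ K) (hKT : K ≤ T) (hβ : 0 < β) (hc' : 0 ≤ c')
    (hα : α = c * (β / B) * √(L / (T * K))) {k reg : ℕ → ℝ} (hk0 : ∀ t, 0 ≤ k t)
    (hk : ∑ t ∈ Finset.range T, k t ≤ 4 * K * Real.log (1 + T))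
    (hreg : ∀ t < T, reg t ≤ (4 * B + 144 * B ^ 2 * (α * (t + 1)) / β) * k t +
      2 * β * c' * L / (α * (t + 1))) :
    ∃ t < T, reg t ≤ (64 + 1152 * c + 6 * c' / c) * B * √(K * L * Real.log T ^ 2 / T) := by
  have hT0 : (0 : ℝ) < T := by positivity
  have hT2 : (2 : ℝ) ≤ T := by exact_mod_cast hT
  have hL0 : 1 / 2 ≤ L := half_le_log_two.trans hL
  have hLpos : 0 < L := by linarith
  have hKpos : 0 < K := by linarith
  have hlogT : 1 / 2 ≤ Real.log T := half_le_log_two.trans (Real.log_le_log (by norm_num) hT2)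
  set s := √(T * K * L) with hs
  have hspos : 0 < s := Real.sqrt_pos.2 (by positivity)
  have hsq : s ^ 2 = T * K * L := Real.sq_sqrt (by positivity)
  rw [sqrt_div_eq (by positivity), ← hs] at hα
  have hαpos : 0 < α := by rw [hα]; positivity
  have hrhs : √(K * L * Real.log T ^ 2 / T) = s * Real.log T / T := by
    rw [Real.sqrt_eq_iff_mul_self_eq (by positivity) (by positivity)]
    have : s * Real.log T / T * (s * Real.log T / T) = s ^ 2 * Real.log T ^ 2 / T ^ 2 := by ring
    rw [this, hsq]
    field_simp
  rw [hrhs]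
  by_contra hcon
  push Not at hcon
  have hlog1 : Real.log (1 + T) ≤ 2 * Real.log T := by
    rw [← Real.log_rpow hT0]
    refine Real.log_le_log (by positivity) ?_
    rw [Real.rpow_two]
    nlinarith
  have hKs : K ≤ 2 * s := by
    refine le_of_sq_le_sq ?_ (by positivity)
    rw [mul_pow, hsq]
    nlinarith [mul_le_mul_of_nonneg_left hKT hKpos.le, mul_pos hT0 hKpos]
  have hstep : ∀ t ∈ Finset.range T, reg t ≤ (4 * B + 144 * B * c * s / K) * k t +
      2 * c' * B * s / c * ((t : ℝ) + 1)⁻¹ := by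
    intro t ht
    have htT := Finset.mem_range.1 ht
    refine (hreg t htT).trans (add_le_add (mul_le_mul_of_nonneg_right ?_ (hk0 t)) (le_of_eq ?_))
    · have h1 : (t : ℝ) + 1 ≤ T := by exact_mod_cast htT
      have h2 : 144 * B * c * s / K = 144 * B ^ 2 * (α * T) / β := by
        rw [hα]; field_simp
      rw [h2]
      gcongr
    · rw [hα]
      have h1 : L = s ^ 2 / (T * K) := by rw [hsq]; field_simp
      rw [h1]
      field_simp
  have hsum := Finset.sum_le_sum hstep
  rw [Finset.sum_add_distrib, ← Finset.mul_sum, ← Finset.mul_sum] at hsum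
  have h1 : (4 * B + 144 * B * c * s / K) * ∑ t ∈ Finset.range T, k t ≤
      (4 * B + 144 * B * c * s / K) * (8 * K * Real.log T) :=
    mul_le_mul_of_nonneg_left (hk.trans (by nlinarith)) (by positivity)
  have h2 : 2 * c' * B * s / c * ∑ t ∈ Finset.range T, ((t : ℝ) + 1)⁻¹ ≤
      2 * c' * B * s / c * (3 * Real.log T) :=
    mul_le_mul_of_nonneg_left ((sum_inv_succ_le T).trans (by linarith)) (by positivity)
  have h3 : (4 * B + 144 * B * c * s / K) * (8 * K * Real.log T) ≤
      (64 + 1152 * c) * B * s * Real.log T := by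
    have e : (4 * B + 144 * B * c * s / K) * (8 * K * Real.log T) =
        32 * B * Real.log T * K + 1152 * c * B * s * Real.log T := by field_simp; ring
    rw [e]
    have : 32 * B * Real.log T * K ≤ 32 * B * Real.log T * (2 * s) :=
      mul_le_mul_of_nonneg_left hKs (by positivity)
    linarith
  have hlow : (T : ℝ) * ((64 + 1152 * c + 6 * c' / c) * B * (s * Real.log T / T)) <
      ∑ t ∈ Finset.range T, reg t := by
    have := Finset.sum_lt_sum_of_nonempty (s := Finset.range T) (f := fun _ =>
      (64 + 1152 * c + 6 * c' / c) * B * (s * Real.log T / T)) (g := reg)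
      (Finset.nonempty_range_iff.2 (by omega)) fun t ht => hcon t (Finset.mem_range.1 ht)
    simpa using this
  have e : (T : ℝ) * ((64 + 1152 * c + 6 * c' / c) * B * (s * Real.log T / T)) =
      (64 + 1152 * c) * B * s * Real.log T + 2 * c' * B * s / c * (3 * Real.log T) := by
    field_simp
    ring
  linarith

namespace DCMDP

variable {S A : Type*} {M : DCMDP S A} {πref πstar : Policy S A} {β Rmax Vmax α : ℝ}
  {Pi : Finset (Policy S A)} {upd : List M.Sample → Policy S A}

/-! ### The iterates of the algorithm -/

theorem IsUpdate.current_mem (hupd : M.IsUpdate πref β α Pi upd) {D : List M.Sample}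
    (hD : D ≠ []) : current πref upd D ∈ Pi ∧
      ∀ π ∈ Pi, M.objective πref β α D (current πref upd D) ≤ M.objective πref β α D π := by
  cases D with
  | nil => exact absurd rfl hD
  | cons z D => exact hupd _ hD

theorem IsUpdate.support_subset (hupd : M.IsUpdate πref β α Pi upd)
    (hb : M.BoundedRatios πref β Vmax Pi) (D : List M.Sample) :
    (M.trajLaw (current πref upd D)).support ⊆ (M.trajLaw πref).support := by
  cases D with
  | nil => exact subset_rfl
  | cons z D => exact hb.support_subset (hupd.current_mem (List.cons_ne_nil z D)).1

theorem sum_observedTerm (π : Policy S A) (D : List M.Sample) :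
    (D.map (observedTerm πref πstar β α π)).sum =
      (M.objective πref β α D πstar - M.objective πref β α D π) / 4 := by
  induction D with
  | nil => simp [objective]
  | cons z D ih =>
    rw [List.map_cons, List.sum_cons, ih]
    simp only [objective, List.map_cons, List.sum_cons, observedTerm, halfLogLikelihood, logit]
    ring

/-- What the concentration event says about an iterate. -/
theorem IsUpdate.sum_expectHellinger_le (hupd : M.IsUpdate πref β α Pi upd) (hstar : πstar ∈ Pi)
    {D : List M.Sample} {L : ℝ} {t : ℕ} (ht : 1 ≤ t) (htD : t ≤ D.length)
    (hD : ∀ π ∈ Pi, process πref upd (observedTerm πref πstar β α π)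
      (M.compensator πref πstar β Vmax α π) (D.take t) ≤ L) :
    ∑ j ∈ Finset.range t, M.expectHellinger πref πstar β (current πref upd (D.take t))
        (current πref upd (D.take j)) +
      t * (α / 2 * M.logGap πref πstar (current πref upd (D.take t))) ≤
      2 * L + t * ((2 * Vmax / β) ^ 2 * (α / 2) ^ 2 / 2) := by
  have hlen : (D.take t).length = t := by rw [List.length_take, min_eq_left htD]
  have hne : D.take t ≠ [] := List.ne_nil_of_length_pos (by omega)
  obtain ⟨hmem, hmin⟩ := hupd.current_mem hne
  have h := hD _ hmem
  have hobj := hmin πstar hstar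
  rw [process, sum_observedTerm, hlen] at h
  have hsum : ∑ j ∈ Finset.range t, M.compensator πref πstar β Vmax α
      (current πref upd (D.take t)) (current πref upd ((D.take t).take j)) =
      (∑ j ∈ Finset.range t, M.expectHellinger πref πstar β (current πref upd (D.take t))
        (current πref upd (D.take j)) +
      t * (α / 2 * M.logGap πref πstar (current πref upd (D.take t))) -
      t * ((2 * Vmax / β) ^ 2 * (α / 2) ^ 2 / 2)) / 2 := by
    have : ∀ j ∈ Finset.range t, M.compensator πref πstar β Vmax α
        (current πref upd (D.take t)) (current πref upd ((D.take t).take j)) =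
        (M.expectHellinger πref πstar β (current πref upd (D.take t))
          (current πref upd (D.take j)) +
        (α / 2 * M.logGap πref πstar (current πref upd (D.take t)) -
          (2 * Vmax / β) ^ 2 * (α / 2) ^ 2 / 2)) / 2 := by
      intro j hj
      rw [List.take_take, min_eq_left (Finset.mem_range.1 hj).le, compensator]
      ring
    rw [Finset.sum_congr rfl this, ← Finset.sum_div, Finset.sum_add_distrib, Finset.sum_const,
      Finset.card_range, nsmul_eq_mul]
    ring
  rw [hsum] at h
  linarith

theorem expect_sq_le_expectHellinger (hβ : 0 < β) (hR : 0 < Rmax) (hVR : 1 ≤ Vmax + Rmax)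
    (hr : ∀ τ : M.Traj, M.Admissible τ → 0 ≤ M.reward τ ∧ M.reward τ ≤ Rmax)
    (hb : M.BoundedRatios πref β Vmax Pi) (hstar : πstar ∈ Pi)
    (hopt : M.IsOptimal πref β πstar) {π : Policy S A} (hπ : π ∈ Pi) {p : Policy S A}
    (hp : (M.trajLaw p).support ⊆ (M.trajLaw πref).support) :
    expect (M.pairLaw πref (M.trajLaw p))
        (fun x => (M.logit πref β π x - M.rewardGap x) ^ 2) ≤
      576 * ((Vmax + Rmax) * Real.exp (2 * Rmax)) ^ 2 *
        M.expectHellinger πref πstar β π p := by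
  have hV := hb.Vmax_nonneg hβ hstar
  rw [expectHellinger, ← expect_const_mul]
  refine expect_mono (B := (2 * Vmax + Rmax) ^ 2)
    (B' := 576 * ((Vmax + Rmax) * Real.exp (2 * Rmax)) ^ 2) (fun x hx => ?_) (fun x hx => ?_)
    fun x hx => ?_
  · obtain ⟨h1, h2, h3⟩ := mem_support_of_mem_support_pairLaw hp hx
    rw [abs_pow]
    exact pow_le_pow_left₀ (abs_nonneg _) (abs_logit_sub_rewardGap_le hβ hr hb hπ h1 h2) 2
  · rw [abs_of_nonneg (mul_nonneg (by positivity) (hellinger_nonneg _ _))]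
    exact mul_le_of_le_one_right (by positivity) (hellinger_le_one _ _)
  · obtain ⟨h1, h2, h3⟩ := mem_support_of_mem_support_pairLaw hp hx
    rw [logit_optimal hβ hr hb hstar hopt h1 h2 h3]
    refine (sq_sub_le_hellinger (abs_rewardGap_le hr h1 h2)
      (abs_logit_sub_rewardGap_le hβ hr hb hπ h1 h2)).trans
      (mul_le_mul_of_nonneg_right ?_ (hellinger_nonneg _ _))
    have h4 : (1 + (2 * Vmax + Rmax)) * Real.exp Rmax ≤
        3 * ((Vmax + Rmax) * Real.exp (2 * Rmax)) := by
      rw [← mul_assoc]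
      exact mul_le_mul (by linarith) (Real.exp_le_exp.2 (by linarith)) (Real.exp_pos _).le
        (by linarith)
    have h5 := pow_le_pow_left₀ (by positivity) h4 2
    rw [mul_pow 3] at h5
    linarith

theorem regret_le (hβ : 0 < β)
    (hr : ∀ τ : M.Traj, M.Admissible τ → 0 ≤ M.reward τ ∧ M.reward τ ≤ Rmax)
    (hb : M.BoundedRatios πref β Vmax Pi) (hstar : πstar ∈ Pi)
    (hopt : M.IsOptimal πref β πstar) {π : Policy S A} (hπ : π ∈ Pi) :
    M.value πref β πstar - M.value πref β π ≤ 4 * Vmax + Rmax := by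
  rw [regret_eq hβ hr hb hstar hopt hπ]
  have h1 := abs_expect_le (p := M.pairLaw πref (M.trajLaw π)) fun x hx =>
    abs_logit_sub_rewardGap_le hβ hr hb hπ
      (mem_support_of_mem_support_pairLaw (hb.support_subset hπ) hx).1
      (mem_support_of_mem_support_pairLaw (hb.support_subset hπ) hx).2.1
  have h2 : M.logGap πref πstar π ≤ 2 * Vmax / β :=
    (le_abs_self _).trans (abs_expect_le fun τ hτ => abs_log_sub_log_le hb hstar hπ hτ)
  rw [le_div_iff₀ hβ] at h2
  linarith [le_abs_self (expect (M.pairLaw πref (M.trajLaw π))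
    fun x => M.logit πref β π x - M.rewardGap x)]

/-- On the concentration event, one of the iterates has small regret. -/
theorem exists_iterate_regret_le {c L : ℝ} {T : ℕ} (hc : 0 < c) (hβ : 0 < β) (hR : 0 < Rmax)
    (hVR : 1 ≤ Vmax + Rmax) (hT : 2 ≤ T) (hL : Real.log 2 ≤ L)
    (hr : ∀ τ : M.Traj, M.Admissible τ → 0 ≤ M.reward τ ∧ M.reward τ ≤ Rmax)
    (hb : M.BoundedRatios πref β Vmax Pi) (hstar : πstar ∈ Pi)
    (hopt : M.IsOptimal πref β πstar)
    (hα : α = c * (β / ((Vmax + Rmax) * Real.exp (2 * Rmax))) *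
      √(L / (T * (M.coverability Pi).toReal)))
    (hupd : M.IsUpdate πref β α Pi upd) {D : List M.Sample} (hlen : D.length = T)
    (hD : ∀ t, 1 ≤ t → t ≤ T → ∀ π ∈ Pi, process πref upd (observedTerm πref πstar β α π)
      (M.compensator πref πstar β Vmax α π) (D.take t) ≤ L) :
    ∃ t ≤ T, current πref upd (D.take t) ∈ Pi ∧
      M.value πref β πstar - M.value πref β (current πref upd (D.take t)) ≤
        (64 + 1152 * c + 6 * (2 + c ^ 2 / 2) / c) * ((Vmax + Rmax) * Real.exp (2 * Rmax)) *
          √((M.coverability Pi).toReal * L * Real.log T ^ 2 / T) := by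
  have hV := hb.Vmax_nonneg hβ hstar
  have hK := one_le_toReal_coverability (M := M) hstar
  have hVB : Vmax + Rmax ≤ (Vmax + Rmax) * Real.exp (2 * Rmax) :=
    le_mul_of_one_le_right (by linarith) (Real.one_le_exp (by linarith))
  have hsqH := fun {π} (hπ : π ∈ Pi) {p : Policy S A} =>
    expect_sq_le_expectHellinger (p := p) hβ hR hVR hr hb hstar hopt hπ
  set B := (Vmax + Rmax) * Real.exp (2 * Rmax) with hBdef
  set K := (M.coverability Pi).toReal with hKdef
  have hB : 0 < B := by positivity
  have hL2 := half_le_log_two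
  have hLpos : 0 < L := by linarith
  have hT2 : (2 : ℝ) ≤ T := by exact_mod_cast hT
  have hT0 : (0 : ℝ) < T := by linarith
  have hmem : ∀ t, current πref upd (D.take (t + 1)) ∈ Pi := fun t =>
    (hupd.current_mem (List.ne_nil_of_length_pos (by rw [List.length_take]; omega))).1
  rcases le_or_gt K T with hKT | hKT
  · obtain ⟨μ, hμ⟩ := exists_covering (M := M) ⟨πstar, hstar⟩
    set q : ℕ → PMF (M.Traj × M.Traj) := fun t =>
      M.pairLaw πref (M.trajLaw (current πref upd (D.take (t + 1)))) with hq
    have hC : 0 ≤ 2 * K := by linarith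
    have hcov : ∀ i x, (q i x).toReal ≤ 2 * K * (M.pairLaw πref μ x).toReal := by
      intro i x
      simp only [hq]
      rw [pairLaw_apply, pairLaw_apply, ENNReal.toReal_mul, ENNReal.toReal_mul, ← mul_assoc]
      exact mul_le_mul_of_nonneg_right (hμ _ (hmem i) x.1) ENNReal.toReal_nonneg
    have hαpos : 0 < α := by
      rw [hα]
      have : 0 < √(L / (T * K)) := Real.sqrt_pos.2 (by positivity)
      positivity
    have hαsq : (2 * Vmax / β) ^ 2 * (α / 2) ^ 2 / 2 ≤ c ^ 2 / 2 * L / T := by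
      have e : (2 * Vmax / β) ^ 2 * (α / 2) ^ 2 / 2 = (Vmax / B) ^ 2 * (c ^ 2 / 2 * L / T) / K := by
        rw [hα, div_pow (c * (β / B) * √(L / (T * K))), mul_pow, Real.sq_sqrt (by positivity)]
        field_simp
      rw [e]
      have h1 : (Vmax / B) ^ 2 ≤ 1 :=
        pow_le_one₀ (by positivity) ((div_le_one hB).2 (by linarith))
      refine (div_le_self (by positivity) hK).trans (mul_le_of_le_one_left (by positivity) h1)
    obtain ⟨t, ht, hreg⟩ := exists_regret_le (c' := 2 + c ^ 2 / 2)
      (k := fun t => ∑' x, novelty q (M.pairLaw πref μ) (2 * K) t x)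
      (reg := fun t => M.value πref β πstar -
        M.value πref β (current πref upd (D.take (t + 1)))) hT hc hB hL hK hKT hβ
      (by positivity) hα (fun t => tsum_nonneg fun x => novelty_nonneg hC t x)
      (by
        have := sum_tsum_novelty_le hC hcov T
        linarith) (by
        intro t ht
        have hα' : 0 < α * ((t : ℝ) + 1) := by positivity
        set η := 4 * β / (576 * B ^ 2 * (α * (t + 1))) with hη
        have hηpos : 0 < η := by positivity
        set π := current πref upd (D.take (t + 1)) with hπdef
        have hπ : π ∈ Pi := hmem t
        have hbound : ∀ i, ∀ x ∈ (q i).support,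
            |M.logit πref β π x - M.rewardGap x| ≤ 2 * Vmax + Rmax := fun i x hx =>
          abs_logit_sub_rewardGap_le hβ hr hb hπ
            (mem_support_of_mem_support_pairLaw (hb.support_subset (hmem i)) hx).1
            (mem_support_of_mem_support_pairLaw (hb.support_subset (hmem i)) hx).2.1
        have h1 := expect_abs_le_novelty hC hcov (by positivity) hηpos hbound t
        have h2 : expect (q t) (fun x => M.logit πref β π x - M.rewardGap x) ≤
            expect (q t) (fun x => |M.logit πref β π x - M.rewardGap x|) :=
          expect_mono (hbound t) (fun x hx => by rw [abs_abs]; exact hbound t x hx)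
            fun x _ => le_abs_self _
        have h3 : ∑ i ∈ Finset.range t,
            expect (q i) (fun x => (M.logit πref β π x - M.rewardGap x) ^ 2) ≤
            576 * B ^ 2 * ((2 + c ^ 2 / 2) * L -
              (t + 1) * (α / 2 * M.logGap πref πstar π)) := by
          have h4 := hupd.sum_expectHellinger_le hstar (by omega : 1 ≤ t + 1)
            (by omega) (hD (t + 1) (by omega) (by omega))
          rw [← hπdef, Finset.sum_range_succ'] at h4
          have h5 : 0 ≤ M.expectHellinger πref πstar β π (current πref upd (D.take 0)) :=
            expect_nonneg fun x _ => hellinger_nonneg _ _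
          have h6 : ((t + 1 : ℕ) : ℝ) * ((2 * Vmax / β) ^ 2 * (α / 2) ^ 2 / 2) ≤
              c ^ 2 / 2 * L := by
            have h7 : ((t + 1 : ℕ) : ℝ) ≤ T := by exact_mod_cast ht
            calc _ ≤ (T : ℝ) * (c ^ 2 / 2 * L / T) := by gcongr
              _ = _ := by field_simp
          calc _ ≤ ∑ i ∈ Finset.range t, 576 * B ^ 2 *
                M.expectHellinger πref πstar β π (current πref upd (D.take (i + 1))) :=
                Finset.sum_le_sum fun i _ => hsqH hπ (hb.support_subset (hmem i))
            _ ≤ _ := by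
                rw [← Finset.mul_sum]
                refine mul_le_mul_of_nonneg_left ?_ (by positivity)
                push_cast at h4 h6
                linarith
        have h4 : η / 2 * ∑ i ∈ Finset.range t,
            expect (q i) (fun x => (M.logit πref β π x - M.rewardGap x) ^ 2) ≤
            2 * β * (2 + c ^ 2 / 2) * L / (α * (t + 1)) - β * M.logGap πref πstar π := by
          refine (mul_le_mul_of_nonneg_left h3 (by positivity)).trans (le_of_eq ?_)
          rw [hη]
          field_simp
          ring
        have h5 : (2 * (2 * Vmax + Rmax) + 1 / η) ≤ 4 * B + 144 * B ^ 2 * (α * (t + 1)) / β := by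
          have : 1 / η = 144 * B ^ 2 * (α * (t + 1)) / β := by
            rw [hη]
            field_simp
            norm_num
          rw [this]
          linarith
        have hk : 0 ≤ ∑' x, novelty q (M.pairLaw πref μ) (2 * K) t x :=
          tsum_nonneg fun x => novelty_nonneg hC t x
        have h6 := mul_le_mul_of_nonneg_right h5 hk
        rw [regret_eq hβ hr hb hstar hopt hπ]
        linarith)
    exact ⟨t + 1, ht, hmem t, hreg⟩
  · refine ⟨1, by omega, hmem 0, (regret_le hβ hr hb hstar hopt (hmem 0)).trans ?_⟩
    have hlogT : 1 / 2 ≤ Real.log T := hL2.trans (Real.log_le_log (by norm_num) hT2)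
    have h1 : 1 / 4 ≤ √(K * L * Real.log T ^ 2 / T) := by
      refine Real.le_sqrt_of_sq_le ?_
      rw [le_div_iff₀ hT0]
      have h2 : (1 / 2 : ℝ) ^ 2 ≤ Real.log T ^ 2 := pow_le_pow_left₀ (by norm_num) hlogT 2
      have h3 : (T : ℝ) * (1 / 2) ≤ K * L :=
        mul_le_mul hKT.le (by linarith) (by norm_num) (by linarith)
      have h4 := mul_le_mul h3 h2 (by norm_num) (by positivity)
      linarith
    have h5 : 64 * B * (1 / 4) ≤ (64 + 1152 * c + 6 * (2 + c ^ 2 / 2) / c) * B *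
        √(K * L * Real.log T ^ 2 / T) := by
      have : 0 ≤ 1152 * c + 6 * (2 + c ^ 2 / 2) / c := by positivity
      gcongr
      linarith
    linarith

theorem lexpect_bad_le (hβ : 0 < β)
    (hr : ∀ τ : M.Traj, M.Admissible τ → 0 ≤ M.reward τ ∧ M.reward τ ≤ Rmax)
    (hb : M.BoundedRatios πref β Vmax Pi) (hstar : πstar ∈ Pi)
    (hopt : M.IsOptimal πref β πstar) (hupd : M.IsUpdate πref β α Pi upd) {δ : ℝ} (hδ : 0 < δ)
    {T : ℕ} (hT : 0 < T) :
    lexpect (dataLaw πref upd T) ({D | ∃ t, 1 ≤ t ∧ t ≤ T ∧ ∃ π ∈ Pi,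
        Real.log (Pi.card * T / δ) < process πref upd (observedTerm πref πstar β α π)
          (M.compensator πref πstar β Vmax α π) (D.take t)}.indicator 1) ≤
      ENNReal.ofReal δ := by
  refine (lexpect_exists_process_le Pi (fun π hπ D => lexpect_exp_observedTerm_le_one hβ hr hb
    hstar hopt α hπ (hupd.support_subset hb D)) _ T).trans (le_of_eq ?_)
  have hcard : (0 : ℝ) < Pi.card := by exact_mod_cast Finset.card_pos.2 ⟨πstar, hstar⟩
  have hT' : (0 : ℝ) < T := by exact_mod_cast hT
  rw [Real.exp_neg, Real.exp_log (by positivity), ← ENNReal.ofReal_natCast T,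
    ← ENNReal.ofReal_natCast Pi.card, ← ENNReal.ofReal_mul hcard.le, ← ENNReal.ofReal_mul hT'.le]
  congr 1
  field_simp

end DCMDP

end

end XPO

theorem theorem1 (c : ℝ) (hc : 0 < c) :
    ∃ C : ℝ, 0 < C ∧
      ∀ (S A : Type*) (M : XPO.DCMDP S A) (πref : XPO.Policy S A)
        (Pi : Finset (XPO.Policy S A)) (πstar : XPO.Policy S A)
        (β Rmax Vmax δ : ℝ) (T : ℕ) (α : ℝ) (upd : List M.Sample → XPO.Policy S A),
        0 < β → 0 < Rmax → 1 ≤ Vmax + Rmax → 0 < δ → δ < 1 → 2 ≤ T →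
        (∀ τ : M.Traj, M.Admissible τ → 0 ≤ M.reward τ ∧ M.reward τ ≤ Rmax) →
        M.IsOptimal πref β πstar →
        πstar ∈ Pi →
        M.BoundedRatios πref β Vmax Pi →
        α = c * (β / ((Vmax + Rmax) * Real.exp (2 * Rmax))) *
          Real.sqrt (Real.log (Pi.card * T / δ) / (T * (M.coverability Pi).toReal)) →
        M.IsUpdate πref β α Pi upd →
        ENNReal.ofReal (1 - δ) ≤
          (XPO.DCMDP.dataLaw πref upd T).toOuterMeasure
            {D | ∀ πhat : XPO.Policy S A, XPO.DCMDP.IsOutput πref β upd T D πhat →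
              M.J πref β πstar - M.J πref β πhat ≤
                ((C * ((Vmax + Rmax) * Real.exp (2 * Rmax)) *
                  Real.sqrt ((M.coverability Pi).toReal * Real.log (Pi.card * T / δ) *
                    Real.log T ^ 2 / T) : ℝ) : EReal)} := by
  refine ⟨64 + 1152 * c + 6 * (2 + c ^ 2 / 2) / c, by positivity, ?_⟩
  intro S A M πref Pi πstar β Rmax Vmax δ T α upd hβ hR hVR hδ hδ1 hT hr hopt hstar hb hα hupd
  have hcard : (1 : ℝ) ≤ Pi.card := by exact_mod_cast Finset.card_pos.2 ⟨πstar, hstar⟩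
  have hT2 : (2 : ℝ) ≤ T := by exact_mod_cast hT
  have hL : Real.log 2 ≤ Real.log (Pi.card * T / δ) := by
    refine Real.log_le_log (by norm_num) ?_
    rw [le_div_iff₀ hδ]
    nlinarith
  have hbad := XPO.DCMDP.lexpect_bad_le (α := α) hβ hr hb hstar hopt hupd hδ (by omega : 0 < T)
  rw [ENNReal.ofReal_sub _ hδ.le, ENNReal.ofReal_one, tsub_le_iff_right]
  refine le_trans ?_ (add_le_add_right hbad _)
  rw [XPO.toOuterMeasure_eq_lexpect, ← XPO.lexpect_add,
    ← XPO.lexpect_const (XPO.DCMDP.dataLaw πref upd T) 1]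
  refine XPO.lexpect_mono fun D hD => ?_
  by_cases hmem : ∃ t, 1 ≤ t ∧ t ≤ T ∧ ∃ π ∈ Pi, Real.log (Pi.card * T / δ) <
      XPO.DCMDP.process πref upd (XPO.DCMDP.observedTerm πref πstar β α π)
        (M.compensator πref πstar β Vmax α π) (D.take t)
  · refine le_add_left (le_of_eq ?_)
    rw [Set.indicator_of_mem (by exact hmem)]
    rfl
  refine le_add_right (le_of_eq ?_)
  rw [Set.indicator_of_mem]
  · rfl
  intro πhat hhat
  push Not at hmem
  obtain ⟨t, ht, hPi, hreg⟩ := XPO.DCMDP.exists_iterate_regret_le hc hβ hR hVR hT hL hr hb hstar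
    hopt hα hupd (XPO.DCMDP.length_of_mem_support_dataLaw πref upd hD) hmem
  refine (EReal.sub_le_sub le_rfl (hhat.2 t ht)).trans ?_
  rw [XPO.DCMDP.J_eq_value hb hstar, XPO.DCMDP.J_eq_value hb hPi, ← EReal.coe_sub,
    EReal.coe_le_coe_iff]
  exact hreg
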